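/- Let $n\ge 3$, let $a,b\in\mathbb{R}$ with $a<n$ and $b<n$, and consider the model in which $\mathbf{X}=(\mathbf{x}_1,\dots,\mathbf{x}_n)$, $\mathbf{x}_k=(x_{1k},x_{2k})$, is a sample of independent observations from the bivariate normal distribution with means $\mu_1,\mu_2\in\mathbb{R}$, standard deviations $\sigma_1,\sigma_2>0$ and correlation $\rho\in(-1,1)$. Put $\bar x_i=n^{-1}\sum_k x_{ik}$, $s_{ij}=\sum_k (x_{ik}-\bar x_i)(x_{jk}-\bar x_j)$ and $r=s_{12}/\sqrt{s_{11}s_{22}}$. Let $\theta_2=\sigma_2^2(1-\rho^2)$, and take the (improper) prior density, with respect to $d\mu_1\,d\mu_2\,d\sigma_1\,d\sigma_2\,d\rho$ on this parameter space, $$\pi_{ab}(\mu_1,\mu_2,\sigma_1,\sigma_2,\rho)=\frac{1}{\sigma_1^{3-a}\,\sigma_2^{2-b}\,(1-\rho^2)^{2-b/2}}.$$ For real $k>0$ let $\chi^2_k$ be a chi-squared random variable with $k$ degrees of freedom, i.e. one with the Gamma distribution of shape $k/2$ and rate $1/2$, and let $(\chi^2_k)_\alpha$ denote its $\alpha$-quantile.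 (a) For every sample $\mathbf{X}$ with $s_{11}>0$, $s_{22}>0$ and $|r|<1$, the posterior distribution under $\pi_{ab}$ is proper, and the posterior distribution of $\theta_2$ given $\mathbf{X}$ is the distribution of $s_{22}(1-r^2)/\chi^2_{n-b}$, with $\mathbf{X}$ held fixed. In particular, for every $\alpha\in(0,1)$ there is exactly one number $q$ with $P(\theta_2<q\mid\mathbf{X})=1-\alpha$, namely the posterior $(1-\alpha)$-quantile $\theta_{2,1-\alpha}(\mathbf{X})$ of $\theta_2$. (b) For every $\alpha\in(0,1)$ and all $\mu_1,\mu_2\in\mathbb{R}$, $\sigma_1,\sigma_2>0$, $\rho\in(-1,1)$, the frequentist coverage of the one-sided credible interval $(0,\theta_{2,1-\alpha}(\mathbf{X}))$ is $$P\bigl(0<\theta_2<\theta_{2,1-\alpha}(\mathbf{X})\mid \mu_1,\mu_2,\sigma_1,\sigma_2,\rho\bigr)=P\bigl(\chi^2_{n-2}>(\chi^2_{n-b})_\alpha\bigr),$$ which does not depend on $(\mu_1,\mu_2,\sigma_1,\sigma_2,\rho)$. For each such $\alpha$, this coverage equals $1-\alpha$ if and only if $b=2$. -/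

import Mathlib

open MeasureTheory ProbabilityTheory
open scoped ENNReal

namespace BivariateNormal

noncomputable section

/-- The chi-squared distribution with (real) degrees of freedom `k > 0`, that is,
the Gamma distribution with shape `k / 2` and rate `1 / 2`. -/
def chiSquared (k : ℝ) : Measure ℝ := gammaMeasure (k / 2) (1 / 2)

/-- The `p`-quantile of a distribution on the real line: the least `x` whose cumulative
probability is at least `p`. -/
def quantile (ν : Measure ℝ) (p : ℝ) : ℝ := sInf {x : ℝ | p ≤ ν.real (Set.Iic x)}

/-- A sample of `n` points of the plane; `X k 0` and `X k 1` are the coordinates of the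
`k`-th observation. -/
abbrev Sample (n : ℕ) : Type := Fin n → EuclideanSpace ℝ (Fin 2)

/-- The covariance matrix with standard deviations `σ₁`, `σ₂` and correlation `ρ`. -/
def covMatrix (σ₁ σ₂ ρ : ℝ) : Matrix (Fin 2) (Fin 2) ℝ :=
  !![σ₁ ^ 2, ρ * σ₁ * σ₂; ρ * σ₁ * σ₂, σ₂ ^ 2]

/-- The joint law of `n` independent observations from the bivariate normal distribution. -/
def samplingLaw (n : ℕ) (μ₁ μ₂ σ₁ σ₂ ρ : ℝ) : Measure (Sample n) :=
  Measure.pi fun _ : Fin n => multivariateGaussian !₂[μ₁, μ₂] (covMatrix σ₁ σ₂ ρ)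

/-- The sample mean of the `i`-th coordinate. -/
def sampleMean {n : ℕ} (X : Sample n) (i : Fin 2) : ℝ := (∑ k, X k i) / n

/-- The entries `s_{ij}` of the matrix of sums of squares and products about the mean
(rows and columns are numbered `0`, `1`). -/
def scatter {n : ℕ} (X : Sample n) (i j : Fin 2) : ℝ :=
  ∑ k, (X k i - sampleMean X i) * (X k j - sampleMean X j)

/-- The sample correlation coefficient `r`. -/
def sampleCorr {n : ℕ} (X : Sample n) : ℝ :=
  scatter X 0 1 / √(scatter X 0 0 * scatter X 1 1)

/-- The sample is nondegenerate: both sums of squares are positive and `|r| < 1`. -/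
def Nondegenerate {n : ℕ} (X : Sample n) : Prop :=
  0 < scatter X 0 0 ∧ 0 < scatter X 1 1 ∧ |sampleCorr X| < 1

/-- Parameter vectors `(μ₁, μ₂, σ₁, σ₂, ρ)`, carrying Lebesgue measure
`dμ₁ dμ₂ dσ₁ dσ₂ dρ`. -/
abbrev Param : Type := ℝ × ℝ × ℝ × ℝ × ℝ

/-- The parameter space `σ₁ > 0`, `σ₂ > 0`, `-1 < ρ < 1`. -/
def paramSpace : Set Param :=
  {p | match p with
    | (_, _, σ₁, σ₂, ρ) => 0 < σ₁ ∧ 0 < σ₂ ∧ -1 < ρ ∧ ρ < 1}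

/-- The density of the bivariate normal distribution at `x`. -/
def normalDensity (μ₁ μ₂ σ₁ σ₂ ρ : ℝ) (x : EuclideanSpace ℝ (Fin 2)) : ℝ :=
  (2 * Real.pi)⁻¹ * (√(covMatrix σ₁ σ₂ ρ).det)⁻¹ *
    Real.exp (-(1 / 2) *
      (![x 0 - μ₁, x 1 - μ₂] ⬝ᵥ
        Matrix.mulVec (covMatrix σ₁ σ₂ ρ)⁻¹ ![x 0 - μ₁, x 1 - μ₂]))

/-- The likelihood of the parameters given the sample `X`. -/
def likelihood {n : ℕ} (X : Sample n) (μ₁ μ₂ σ₁ σ₂ ρ : ℝ) : ℝ :=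
  ∏ k, normalDensity μ₁ μ₂ σ₁ σ₂ ρ (X k)

/-- The (improper) prior density `π_{ab}`; it is constant in the means. -/
def priorDensity (a b σ₁ σ₂ ρ : ℝ) : ℝ :=
  1 / (σ₁ ^ (3 - a) * σ₂ ^ (2 - b) * (1 - ρ ^ 2) ^ (2 - b / 2))

/-- The measure on the parameter space with density prior times likelihood. -/
def unnormalizedPosterior (a b : ℝ) {n : ℕ} (X : Sample n) : Measure Param :=
  ((volume : Measure Param).restrict paramSpace).withDensity fun p =>
    match p with
    | (μ₁, μ₂, σ₁, σ₂, ρ) =>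
      ENNReal.ofReal (priorDensity a b σ₁ σ₂ ρ * likelihood X μ₁ μ₂ σ₁ σ₂ ρ)

/-- The posterior distribution of `(μ₁, μ₂, σ₁, σ₂, ρ)` under `π_{ab}` given `X`. It is a
probability measure exactly when the integral of prior times likelihood is
positive and finite. -/
def posterior (a b : ℝ) {n : ℕ} (X : Sample n) : Measure Param :=
  (unnormalizedPosterior a b X Set.univ)⁻¹ • unnormalizedPosterior a b X

/-- The conditional variance `θ₂` of the second coordinate given the first. -/
def condVar (σ₂ ρ : ℝ) : ℝ := σ₂ ^ 2 * (1 - ρ ^ 2)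

/-- The marginal posterior distribution of `θ₂` under `π_{ab}` given `X`. -/
def posteriorCondVar (a b : ℝ) {n : ℕ} (X : Sample n) : Measure ℝ :=
  (posterior a b X).map fun p =>
    match p with
    | (_, _, _, σ₂, ρ) => condVar σ₂ ρ

/-- The frequentist coverage, at the parameter `(μ₁, μ₂, σ₁, σ₂, ρ)`, of the one-sided
credible interval for `θ₂` of posterior probability `1 - α`, from the lower limit `0` of the
range of `θ₂` to the posterior `1 - α` quantile of `θ₂`. -/
def coverage (n : ℕ) (a b α μ₁ μ₂ σ₁ σ₂ ρ : ℝ) : ℝ≥0∞ :=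
  samplingLaw n μ₁ μ₂ σ₁ σ₂ ρ
    {X | condVar σ₂ ρ ∈ Set.Ioo 0 (quantile (posteriorCondVar a b X) (1 - α))}

end

end BivariateNormal

namespace BivariateNormal

/-! Both halves rest on one statistic, the residual sum of squares S = s₂₂(1 - r²) of the regression
of the second coordinate on the first.

Bayesian side. Replace (σ₂, ρ) by the conditional variance θ = θ₂ and the regression slope β =
ρσ₂/σ₁; the Jacobian 2σ₂²/σ₁ accounts for the factor σ₂² of the prior, which otherwise is a power of
σ₁ times a power of θ. The likelihood is the marginal density of the first coordinate times the
conditional density of the second, so the means and then β integrate out as Gaussians. What remains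
splits into a σ₁-integral, finite because a < n, and θ^(-(n-b)/2 - 1) exp(-S/(2θ)), the shape of the
law of S/χ²_{n-b} (`exists_lintegral_unnormalizedPosterior`, `posterior_spec`).

Frequentist side. Given the first coordinates, S/θ₂ is the squared length of a standard normal
vector after projection off two orthonormal directions, so it is χ²_{n-2} whatever the parameters
(`map_residual_div_condVar_samplingLaw`).

The posterior (1-α)-quantile is S divided by the α-quantile of χ²_{n-b}, so covering θ₂ means that
S/θ₂ exceeds that α-quantile (`coverage_eq`). Since 1-α is the χ²_{n-b} tail at the same point,
exact coverage compares two gamma tails there, and these are strictly monotone in the shape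
(`gammaMeasure_Ioi_eq_iff`). -/

/-! ### Quantiles of diffuse laws on the positive half-line -/

/-- A probability law on the line without atoms, carried by `(0, ∞)` and charging every open
subinterval of it. -/
structure IsPositiveDiffuse (ν : Measure ℝ) : Prop where
  prob : IsProbabilityMeasure ν
  singleton : ∀ x, ν {x} = 0
  Iic_zero : ν (Set.Iic 0) = 0
  Ioo_pos : ∀ u v, 0 ≤ u → u < v → 0 < ν (Set.Ioo u v)

namespace IsPositiveDiffuse

variable {ν : Measure ℝ}

lemma nullSingleton (h : IsPositiveDiffuse ν) : NullSingletonClass ν := ⟨h.singleton⟩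

lemma continuous_cdf (h : IsPositiveDiffuse ν) : Continuous (cdf ν) := by
  have := h.prob
  refine continuous_iff_continuousAt.2 fun x => ?_
  have h0 := (cdf ν).measure_singleton x
  rw [measure_cdf, h.singleton x, eq_comm, ENNReal.ofReal_eq_zero, sub_nonpos] at h0
  refine continuousAt_iff_continuous_left'_right'.2 ⟨?_, ?_⟩
  · rw [(monotone_cdf ν).continuousWithinAt_Iio_iff_leftLim_eq]
    exact le_antisymm ((monotone_cdf ν).leftLim_le le_rfl) h0
  · exact ((cdf ν).right_continuous x).mono Set.Ioi_subset_Ici_self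

lemma real_Iic_lt (h : IsPositiveDiffuse ν) {x y : ℝ} (hx : 0 ≤ x) (hxy : x < y) :
    ν.real (Set.Iic x) < ν.real (Set.Iic y) := by
  have := h.prob
  have hsub : Set.Iic x ∪ Set.Ioo x y ⊆ Set.Iic y := by
    rintro z (hz | hz)
    · exact le_trans hz hxy.le
    · exact hz.2.le
  have hd : Disjoint (Set.Iic x) (Set.Ioo x y) := by
    rw [Set.disjoint_left]
    intro z hz hz'
    exact absurd hz'.1 (not_lt.2 hz)
  have h1 := measureReal_mono (μ := ν) hsub
  rw [measureReal_union hd measurableSet_Ioo] at h1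
  have h2 : 0 < ν.real (Set.Ioo x y) :=
    ENNReal.toReal_pos (h.Ioo_pos x y hx hxy).ne' (measure_ne_top _ _)
  linarith

lemma pos_of_real_Iic_pos (h : IsPositiveDiffuse ν) {x : ℝ} (hx : 0 < ν.real (Set.Iic x)) :
    0 < x := by
  by_contra! hx0
  have : ν (Set.Iic x) = 0 := measure_mono_null (Set.Iic_subset_Iic.2 hx0) h.Iic_zero
  simp [measureReal_def, this] at hx

/-- The distribution function is continuous, so it takes the value p. Since p > 0, every solution
lies in (0, ∞), where the function is strictly increasing. -/
lemma real_Iic_eq_iff (h : IsPositiveDiffuse ν) {p : ℝ} (hp0 : 0 < p) (hp1 : p < 1) (x : ℝ) :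
    ν.real (Set.Iic x) = p ↔ x = quantile ν p := by
  have := h.prob
  obtain ⟨x₀, hx₀⟩ : ∃ x, ν.real (Set.Iic x) = p := by
    have hb : ∀ᶠ x in Filter.atBot, cdf ν x < p := (tendsto_cdf_atBot ν).eventually_lt_const hp0
    have ht : ∀ᶠ x in Filter.atTop, p < cdf ν x := (tendsto_cdf_atTop ν).eventually_const_lt hp1
    obtain ⟨u, hu⟩ := hb.exists
    obtain ⟨v, hv⟩ := ht.exists
    obtain ⟨x, hx⟩ := mem_range_of_exists_le_of_exists_ge h.continuous_cdf ⟨u, hu.le⟩ ⟨v, hv.le⟩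
    exact ⟨x, by rw [← cdf_eq_real, hx]⟩
  have hx₀pos : 0 < x₀ := h.pos_of_real_Iic_pos (hx₀ ▸ hp0)
  have hset : {x : ℝ | p ≤ ν.real (Set.Iic x)} = Set.Ici x₀ := by
    ext y
    simp only [Set.mem_ofPred_eq, Set.mem_Ici]
    constructor
    · intro hy
      by_contra! hlt
      have hy0 : 0 < y := h.pos_of_real_Iic_pos (hp0.trans_le hy)
      have := h.real_Iic_lt hy0.le hlt
      linarith
    · intro hy
      rw [← hx₀]
      exact measureReal_mono (Set.Iic_subset_Iic.2 hy)
  have hq : quantile ν p = x₀ := by rw [quantile, hset, csInf_Ici]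
  rw [hq]
  constructor
  · intro hx
    have hxpos : 0 < x := h.pos_of_real_Iic_pos (hx ▸ hp0)
    rcases lt_trichotomy x x₀ with hlt | heq | hgt
    · have := h.real_Iic_lt hxpos.le hlt
      linarith
    · exact heq
    · have := h.real_Iic_lt hx₀pos.le hgt
      linarith
  · rintro rfl
    exact hx₀

lemma real_Iic_quantile (h : IsPositiveDiffuse ν) {p : ℝ} (hp0 : 0 < p) (hp1 : p < 1) :
    ν.real (Set.Iic (quantile ν p)) = p := (h.real_Iic_eq_iff hp0 hp1 _).2 rfl

lemma quantile_pos (h : IsPositiveDiffuse ν) {p : ℝ} (hp0 : 0 < p) (hp1 : p < 1) :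
    0 < quantile ν p := h.pos_of_real_Iic_pos (by rwa [h.real_Iic_quantile hp0 hp1])

lemma Iio_eq_iff (h : IsPositiveDiffuse ν) {p : ℝ} (hp0 : 0 < p) (hp1 : p < 1) (x : ℝ) :
    ν (Set.Iio x) = ENNReal.ofReal p ↔ x = quantile ν p := by
  have := h.prob
  have := h.nullSingleton
  rw [← h.real_Iic_eq_iff hp0 hp1, measure_congr (Iio_ae_eq_Iic (μ := ν) (a := x)),
    measureReal_def, ← ENNReal.toReal_eq_toReal_iff' (measure_ne_top _ _) ENNReal.ofReal_ne_top,
    ENNReal.toReal_ofReal hp0.le]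

lemma Ioi_quantile (h : IsPositiveDiffuse ν) {p : ℝ} (hp0 : 0 < p) (hp1 : p < 1) :
    ν (Set.Ioi (quantile ν p)) = ENNReal.ofReal (1 - p) := by
  have := h.prob
  rw [← ofReal_measureReal, ← Set.compl_Iic, probReal_compl_eq_one_sub measurableSet_Iic,
    h.real_Iic_quantile hp0 hp1]

lemma map_const_div (h : IsPositiveDiffuse ν) {S : ℝ} (hS : 0 < S) :
    IsPositiveDiffuse (ν.map fun y => S / y) := by
  have hm : Measurable fun y : ℝ => S / y := by fun_prop
  have := h.prob
  refine ⟨Measure.isProbabilityMeasure_map hm.aemeasurable, fun x => ?_, ?_, fun u v hu huv => ?_⟩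
  · rw [Measure.map_apply hm (measurableSet_singleton x)]
    refine measure_mono_null ?_ (h.singleton (S / x))
    rintro y (hy : S / y = x)
    rw [Set.mem_singleton_iff, ← hy, div_div_cancel₀ hS.ne']
  · rw [Measure.map_apply hm measurableSet_Iic]
    refine measure_mono_null ?_ h.Iic_zero
    rintro y (hy : S / y ≤ 0)
    by_contra hy0
    exact absurd hy (not_le.2 (div_pos hS (not_le.1 hy0)))
  · rw [Measure.map_apply hm measurableSet_Ioo]
    -- Passing to the upper half of the interval avoids u = 0, where S / u would be 0 by convention.
    have hmid : u < (u + v) / 2 ∧ (u + v) / 2 < v := ⟨by linarith, by linarith⟩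
    have hmpos : 0 < (u + v) / 2 := by linarith
    have hvpos : 0 < v := by linarith
    refine (h.Ioo_pos (S / v) (S / ((u + v) / 2)) (by positivity)
      (div_lt_div_of_pos_left hS hmpos hmid.2)).trans_le (measure_mono ?_)
    rintro y ⟨hy1, hy2⟩
    have hypos : 0 < y := lt_trans (by positivity) hy1
    refine ⟨hmid.1.trans ?_, ?_⟩
    · rwa [lt_div_comm₀ hypos hmpos] at hy2
    · rwa [div_lt_comm₀ hvpos hypos] at hy1

/-- On (0, ∞) the map y ↦ S / y is decreasing, so it exchanges lower and upper tails; without atoms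
the boundary point does not matter. -/
lemma quantile_map_const_div (h : IsPositiveDiffuse ν) {S p : ℝ} (hS : 0 < S)
    (hp0 : 0 < p) (hp1 : p < 1) :
    quantile (ν.map fun y => S / y) (1 - p) = S / quantile ν p := by
  have hm : Measurable fun y : ℝ => S / y := by fun_prop
  have := h.prob
  have := h.nullSingleton
  have hq := h.quantile_pos hp0 hp1
  symm
  rw [← (h.map_const_div hS).real_Iic_eq_iff (by linarith) (by linarith),
    map_measureReal_apply hm measurableSet_Iic]
  have h1 : (fun y => S / y) ⁻¹' Set.Iic (S / quantile ν p) =ᵐ[ν] Set.Ici (quantile ν p) := by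
    have h0 : ∀ᵐ y ∂ν, y ∉ Set.Iic (0 : ℝ) := measure_eq_zero_iff_ae_notMem.1 h.Iic_zero
    filter_upwards [h0] with y hy
    have hy0 : 0 < y := by simpa using hy
    apply propext
    change S / y ≤ S / quantile ν p ↔ quantile ν p ≤ y
    rw [div_le_div_iff_of_pos_left hS hy0 hq]
  rw [measureReal_congr h1, measureReal_congr (Ioi_ae_eq_Ici (μ := ν) (a := quantile ν p)).symm,
    ← Set.compl_Iic, probReal_compl_eq_one_sub measurableSet_Iic, h.real_Iic_quantile hp0 hp1]

end IsPositiveDiffuse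

/-! ### Gamma laws and their dependence on the shape -/

lemma isPositiveDiffuse_gammaMeasure {a r : ℝ} (ha : 0 < a) (hr : 0 < r) :
    IsPositiveDiffuse (gammaMeasure a r) := by
  refine ⟨isProbabilityMeasure_gammaMeasure ha hr, fun x => ?_, ?_, fun u v hu huv => ?_⟩
  · exact withDensity_absolutelyContinuous _ _ (by simp)
  · rw [gammaMeasure, withDensity_apply _ measurableSet_Iic,
      setLIntegral_congr Iio_ae_eq_Iic.symm]
    exact lintegral_gammaPDF_of_nonpos le_rfl
  · rw [gammaMeasure, withDensity_apply _ measurableSet_Ioo,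
      setLIntegral_pos_iff (f := gammaPDF a r) (measurable_gammaPDFReal a r).ennreal_ofReal]
    have : Set.Ioo u v ⊆ Function.support (gammaPDF a r) ∩ Set.Ioo u v := by
      intro x hx
      refine ⟨?_, hx⟩
      rw [Function.mem_support, gammaPDF, ne_eq, ENNReal.ofReal_eq_zero, not_le]
      exact gammaPDFReal_pos ha hr (hu.trans_lt hx.1)
    refine lt_of_lt_of_le ?_ (measure_mono this)
    simpa using huv

lemma isPositiveDiffuse_chiSquared {k : ℝ} (hk : 0 < k) : IsPositiveDiffuse (chiSquared k) :=
  isPositiveDiffuse_gammaMeasure (by positivity) (by positivity)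

lemma gammaPDF_eq_mul_rpow {p q r x : ℝ} (hp : 0 < p) (hq : 0 < q) (hr : 0 < r) (hx : 0 < x) :
    gammaPDF q r x = ENNReal.ofReal (r ^ (q - p) * Real.Gamma p / Real.Gamma q * x ^ (q - p)) *
      gammaPDF p r x := by
  have h1 := Real.Gamma_pos_of_pos hp
  have h2 := Real.Gamma_pos_of_pos hq
  rw [gammaPDF_of_nonneg hx.le, gammaPDF_of_nonneg hx.le, ← ENNReal.ofReal_mul (by positivity)]
  congr 1
  have e1 : r ^ q = r ^ (q - p) * r ^ p := by rw [← Real.rpow_add hr]; ring_nf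
  have e2 : x ^ (q - 1) = x ^ (q - p) * x ^ (p - 1) := by rw [← Real.rpow_add hx]; ring_nf
  rw [e1, e2]
  field_simp

/-- The gamma laws are strictly stochastically increasing in the shape. -/
lemma gammaMeasure_Ioi_ne_of_lt {p q r x : ℝ} (hp : 0 < p) (hpq : p < q) (hr : 0 < r)
    (hx : 0 < x) : gammaMeasure p r (Set.Ioi x) ≠ gammaMeasure q r (Set.Ioi x) := by
  intro heq
  have hq := hp.trans hpq
  have hP := isPositiveDiffuse_gammaMeasure hp hr
  have hQ := isPositiveDiffuse_gammaMeasure hq hr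
  have := hP.prob
  have := hQ.prob
  have hΓp := Real.Gamma_pos_of_pos hp
  have hΓq := Real.Gamma_pos_of_pos hq
  have hIic : gammaMeasure p r (Set.Iic x) = gammaMeasure q r (Set.Iic x) := by
    rw [← Set.compl_Ioi, prob_compl_eq_one_sub measurableSet_Ioi,
      prob_compl_eq_one_sub measurableSet_Ioi, heq]
  have hIoc : ∀ s, IsPositiveDiffuse (gammaMeasure s r) →
      gammaMeasure s r (Set.Ioc 0 x) = gammaMeasure s r (Set.Iic x) := by
    intro s hs
    have h0 : ∀ᵐ y ∂(gammaMeasure s r), y ∉ Set.Iic (0 : ℝ) :=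
      measure_eq_zero_iff_ae_notMem.1 hs.Iic_zero
    refine measure_congr ?_
    filter_upwards [h0] with y hy
    have hy0 : 0 < y := by simpa using hy
    apply propext
    change 0 < y ∧ y ≤ x ↔ y ≤ x
    simp [hy0]
  set c : ℝ := r ^ (q - p) * Real.Gamma p / Real.Gamma q with hc
  have hcpos : 0 < c := by positivity
  -- K is the density ratio at x. The ratio increases, so it is at least K above x and less than K
  -- below. Equal tails force K ≤ 1 from the part above x, while the part below x, also of equal
  -- mass, rules out K ≤ 1.
  set K : ℝ≥0∞ := ENNReal.ofReal (c * x ^ (q - p)) with hK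
  have hmeas : ∀ s, Measurable (gammaPDF s r) :=
    fun s => (measurable_gammaPDFReal s r).ennreal_ofReal
  have hupper : K * gammaMeasure p r (Set.Ioi x) ≤ gammaMeasure q r (Set.Ioi x) := by
    rw [gammaMeasure, gammaMeasure, withDensity_apply _ measurableSet_Ioi,
      withDensity_apply _ measurableSet_Ioi, ← lintegral_const_mul _ (hmeas p)]
    refine setLIntegral_mono (hmeas q) fun y (hy : x < y) => ?_
    rw [gammaPDF_eq_mul_rpow hp hq hr (hx.trans hy)]
    gcongr
    exact ENNReal.ofReal_le_ofReal (by gcongr)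
  have hlower : gammaMeasure q r (Set.Ioc 0 x) < K * gammaMeasure p r (Set.Ioc 0 x) := by
    rw [gammaMeasure, gammaMeasure, withDensity_apply _ measurableSet_Ioc,
      withDensity_apply _ measurableSet_Ioc, ← lintegral_const_mul _ (hmeas p)]
    -- At the endpoint x the ratio equals K, so it is dropped to have strict inequality at every
    -- point.
    rw [← setLIntegral_congr Ioo_ae_eq_Ioc, ← setLIntegral_congr Ioo_ae_eq_Ioc]
    refine setLIntegral_strict_mono measurableSet_Ioo (by simp [hx])
      ((hmeas p).const_mul K) ?_ ?_
    · have h1 := measure_ne_top (gammaMeasure q r) (Set.Ioo 0 x)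
      rwa [gammaMeasure, withDensity_apply _ measurableSet_Ioo] at h1
    · refine Filter.Eventually.of_forall fun y hy => ?_
      rw [gammaPDF_eq_mul_rpow hp hq hr hy.1]
      refine ENNReal.mul_lt_mul_left ?_ ENNReal.ofReal_ne_top ?_
      · rw [gammaPDF, ne_eq, ENNReal.ofReal_eq_zero, not_le]
        exact gammaPDFReal_pos hp hr hy.1
      · refine (ENNReal.ofReal_lt_ofReal_iff (by positivity)).2 ?_
        have := Real.rpow_lt_rpow hy.1.le hy.2 (sub_pos.2 hpq)
        gcongr
  rw [hIoc p hP, hIoc q hQ, ← hIic] at hlower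
  rw [← heq] at hupper
  have hIoi_pos : gammaMeasure p r (Set.Ioi x) ≠ 0 :=
    ((hP.Ioo_pos x (x + 1) hx.le (by linarith)).trans_le
      (measure_mono Set.Ioo_subset_Ioi_self)).ne'
  have hK1 : K ≤ 1 := by
    by_contra! hK1
    have := ENNReal.mul_lt_mul_left hIoi_pos (measure_ne_top _ _) hK1
    rw [one_mul] at this
    exact absurd hupper (not_le.2 this)
  have : K * gammaMeasure p r (Set.Iic x) ≤ gammaMeasure p r (Set.Iic x) := by
    calc _ ≤ 1 * gammaMeasure p r (Set.Iic x) := by gcongr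
      _ = _ := one_mul _
  exact absurd hlower (not_lt.2 this)

lemma gammaMeasure_Ioi_eq_iff {p q r x : ℝ} (hp : 0 < p) (hq : 0 < q) (hr : 0 < r) (hx : 0 < x) :
    gammaMeasure p r (Set.Ioi x) = gammaMeasure q r (Set.Ioi x) ↔ p = q := by
  refine ⟨fun h => ?_, fun h => by rw [h]⟩
  rcases lt_trichotomy p q with hlt | heq | hgt
  · exact absurd h (gammaMeasure_Ioi_ne_of_lt hp hlt hr hx)
  · exact heq
  · exact absurd h.symm (gammaMeasure_Ioi_ne_of_lt hq hgt hr hx)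

/-! ### Moment generating functions and sums of squared normals -/

/-- Both complex moment generating functions are analytic on the strip |Re z| < δ and agree on its
real segment. By the identity theorem they agree on the imaginary axis, where they are the
characteristic functions. -/
lemma measure_ext_of_mgf_eqOn {μ ν : Measure ℝ} [IsProbabilityMeasure μ] [IsProbabilityMeasure ν]
    {δ : ℝ} (hδ : 0 < δ)
    (hμ : ∀ t ∈ Set.Ioo (-δ) δ, t ∈ integrableExpSet id μ)
    (hν : ∀ t ∈ Set.Ioo (-δ) δ, t ∈ integrableExpSet id ν)
    (h : ∀ t ∈ Set.Ioo (-δ) δ, mgf id μ t = mgf id ν t) : μ = ν := by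
  have hμ' : Set.Ioo (-δ) δ ⊆ interior (integrableExpSet id μ) :=
    interior_maximal hμ isOpen_Ioo
  have hν' : Set.Ioo (-δ) δ ⊆ interior (integrableExpSet id ν) :=
    interior_maximal hν isOpen_Ioo
  have hA : AnalyticOnNhd ℂ (complexMGF id μ) {z | z.re ∈ Set.Ioo (-δ) δ} :=
    fun z hz => analyticOnNhd_complexMGF z (hμ' hz)
  have hB : AnalyticOnNhd ℂ (complexMGF id ν) {z | z.re ∈ Set.Ioo (-δ) δ} :=
    fun z hz => analyticOnNhd_complexMGF z (hν' hz)
  have hmem : (0 : ℝ) ∈ Set.Ioo (-δ) δ := by simp [hδ]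
  have hpre : IsPreconnected {z : ℂ | z.re ∈ Set.Ioo (-δ) δ} :=
    ((convex_Ioo (-δ) δ).linear_preimage Complex.reLm).isPreconnected
  have hEq : Set.EqOn (complexMGF id μ) (complexMGF id ν) {z | z.re ∈ Set.Ioo (-δ) δ} := by
    refine hA.eqOn_of_preconnected_of_frequently_eq hB hpre (z₀ := ((0 : ℝ) : ℂ))
      (by simp [hδ]) ?_
    have h_ev : ∀ᶠ x : ℝ in nhdsWithin 0 {0}ᶜ, complexMGF id μ x = complexMGF id ν x := by
      refine nhdsWithin_le_nhds ?_
      filter_upwards [isOpen_Ioo.mem_nhds hmem] with x hx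
      rw [complexMGF_ofReal, complexMGF_ofReal, h x hx]
    have ht : Filter.Tendsto (fun x : ℝ => (x : ℂ)) (nhdsWithin 0 {0}ᶜ)
        (nhdsWithin ((0 : ℝ) : ℂ) {((0 : ℝ) : ℂ)}ᶜ) := by
      refine tendsto_nhdsWithin_iff.2
        ⟨(Complex.continuous_ofReal.tendsto 0).mono_left nhdsWithin_le_nhds, ?_⟩
      filter_upwards [self_mem_nhdsWithin] with x hx
      simpa using hx
    exact ht.frequently h_ev.frequently
  refine Measure.ext_of_charFun (funext fun t => ?_)
  rw [← complexMGF_id_mul_I, ← complexMGF_id_mul_I]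
  exact hEq (by simp [hδ])

/-- The integral of a non-integrable function is 0 by convention, so a nonzero value certifies
integrability. -/
lemma mem_integrableExpSet_of_mgf_ne_zero {μ : Measure ℝ} {t : ℝ} (h : mgf id μ t ≠ 0) :
    t ∈ integrableExpSet id μ := by
  by_contra hn
  exact h (integral_undef hn)

lemma mgf_gammaMeasure {a t : ℝ} (ha : 0 < a) (ht : t < 1 / 2) :
    mgf id (gammaMeasure a (1 / 2)) t = (1 - 2 * t) ^ (-a) := by
  have hm : Measurable (gammaPDF a (1 / 2)) := (measurable_gammaPDFReal a _).ennreal_ofReal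
  have hr : 0 < 1 / 2 - t := by linarith
  have hΓ := Real.Gamma_pos_of_pos ha
  rw [mgf, gammaMeasure, integral_withDensity_eq_integral_toReal_smul hm
    (Filter.Eventually.of_forall fun _ => ENNReal.ofReal_lt_top)]
  have h1 : ∀ x : ℝ, (gammaPDF a (1 / 2) x).toReal • Real.exp (t * id x) =
      (Set.Ici (0 : ℝ)).indicator (fun x => (1 / 2) ^ a / Real.Gamma a *
        (x ^ (a - 1) * Real.exp (-((1 / 2 - t) * x)))) x := by
    intro x
    rw [gammaPDF, ENNReal.toReal_ofReal (gammaPDFReal_nonneg ha (by norm_num) x), gammaPDFReal]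
    by_cases hx : 0 ≤ x
    · rw [if_pos hx, Set.indicator_of_mem (by exact hx), smul_eq_mul, mul_assoc, mul_assoc,
        ← Real.exp_add]
      simp only [id]
      ring_nf
    · rw [if_neg hx, Set.indicator_of_notMem (by exact hx), zero_smul]
  simp_rw [h1]
  rw [integral_indicator measurableSet_Ici, integral_Ici_eq_integral_Ioi, integral_const_mul,
    Real.integral_rpow_mul_exp_neg_mul_Ioi ha hr]
  have h2 : (1 - 2 * t) = (1 / 2 - t) / (1 / 2) := by ring
  rw [h2, Real.rpow_neg (by positivity), Real.div_rpow hr.le (by norm_num),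
    Real.div_rpow (by norm_num) hr.le, Real.one_rpow]
  field_simp

lemma integral_exp_mul_sq_gaussianReal {t : ℝ} (ht : t < 1 / 2) :
    ∫ x, Real.exp (t * x ^ 2) ∂(gaussianReal 0 1) = (1 - 2 * t) ^ (-(1 / 2) : ℝ) := by
  rw [integral_gaussianReal_eq_integral_smul (by norm_num)]
  have h1 : ∀ x : ℝ, gaussianPDFReal 0 1 x • Real.exp (t * x ^ 2) =
      (√(2 * Real.pi))⁻¹ * Real.exp (-(1 / 2 - t) * x ^ 2) := by
    intro x
    rw [gaussianPDFReal, smul_eq_mul, mul_assoc, ← Real.exp_add]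
    congr 2
    · simp
    · simp only [NNReal.coe_one, sub_zero, mul_one]
      ring
  simp_rw [h1]
  have hr : 0 < 1 - 2 * t := by linarith
  rw [integral_const_mul, integral_gaussian, Real.rpow_neg hr.le, ← Real.sqrt_eq_rpow,
    ← Real.sqrt_inv, ← Real.sqrt_inv, ← Real.sqrt_mul (by positivity)]
  congr 1
  have : 1 / 2 - t ≠ 0 := by linarith
  have := Real.pi_pos.ne'
  field_simp

/-- The sum of the squares of finitely many independent standard normal variables has a
chi-squared law. -/
lemma map_sum_sq_pi_gaussianReal {ι : Type*} [Fintype ι] [DecidableEq ι] (s : Finset ι)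
    (hs : s.Nonempty) :
    (Measure.pi fun _ : ι => gaussianReal 0 1).map (fun x => ∑ i ∈ s, x i ^ 2) =
      chiSquared s.card := by
  have hcard : (0 : ℝ) < s.card := by exact_mod_cast hs.card_pos
  have hm : Measurable fun x : ι → ℝ => ∑ i ∈ s, x i ^ 2 := by fun_prop
  have := (isPositiveDiffuse_chiSquared hcard).prob
  have := Measure.isProbabilityMeasure_map (μ := Measure.pi fun _ : ι => gaussianReal 0 1)
    hm.aemeasurable
  have h1 : ∀ t < (1 / 2 : ℝ), mgf id (chiSquared s.card) t = (1 - 2 * t) ^ (-(s.card / 2) : ℝ) :=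
    fun t ht => mgf_gammaMeasure (by positivity) ht
  have h2 : ∀ t < (1 / 2 : ℝ),
      mgf id ((Measure.pi fun _ : ι => gaussianReal 0 1).map (fun x => ∑ i ∈ s, x i ^ 2)) t =
        (1 - 2 * t) ^ (-(s.card / 2) : ℝ) := by
    intro t ht
    -- Indices outside s contribute a factor 1, so that the product runs over all coordinates of the
    -- product measure.
    have hprod : ∀ x : ι → ℝ, Real.exp (t * ∑ i ∈ s, x i ^ 2) =
        ∏ i, (fun (i : ι) (y : ℝ) => if i ∈ s then Real.exp (t * y ^ 2) else 1) i (x i) := by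
      intro x
      rw [Finset.mul_sum, Real.exp_sum, Finset.prod_ite_mem, Finset.univ_inter]
    rw [mgf_id_map hm.aemeasurable, mgf]
    simp_rw [hprod]
    rw [integral_fintype_prod_eq_prod
      (f := fun (i : ι) (y : ℝ) => if i ∈ s then Real.exp (t * y ^ 2) else 1)]
    have : ∀ i : ι, ∫ y, (if i ∈ s then Real.exp (t * y ^ 2) else 1) ∂(gaussianReal 0 1) =
        if i ∈ s then (1 - 2 * t) ^ (-(1 / 2) : ℝ) else 1 := by
      intro i
      split_ifs
      · exact integral_exp_mul_sq_gaussianReal ht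
      · simp
    simp_rw [this]
    rw [Finset.prod_ite_mem, Finset.univ_inter, Finset.prod_const, ← Real.rpow_natCast,
      ← Real.rpow_mul (by linarith)]
    ring_nf
  have hne : ∀ t < (1 / 2 : ℝ), (1 - 2 * t) ^ (-(s.card / 2) : ℝ) ≠ 0 :=
    fun t ht => (Real.rpow_pos_of_pos (by linarith) _).ne'
  refine measure_ext_of_mgf_eqOn (δ := 1 / 2) (by norm_num) (fun t ht => ?_) (fun t ht => ?_)
    (fun t ht => ?_)
  · exact mem_integrableExpSet_of_mgf_ne_zero (h2 t ht.2 ▸ hne t ht.2)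
  · exact mem_integrableExpSet_of_mgf_ne_zero (h1 t ht.2 ▸ hne t ht.2)
  · rw [h1 t ht.2, h2 t ht.2]

/-! ### The sample as an affine image of standard normals -/

/-- The sample with given vectors of first and second coordinates. -/
noncomputable def pairSample {n : ℕ} (x y : Fin n → ℝ) : Sample n := fun k => !₂[x k, y k]

lemma covMatrix_posSemidef (σ₁ σ₂ : ℝ) {ρ : ℝ} (h1 : -1 < ρ) (h2 : ρ < 1) :
    (covMatrix σ₁ σ₂ ρ).PosSemidef := by
  have hρ : 0 ≤ 1 - ρ ^ 2 := by nlinarith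
  have : covMatrix σ₁ σ₂ ρ = !![σ₁, 0; ρ * σ₂, σ₂ * √(1 - ρ ^ 2)] *
      (!![σ₁, 0; ρ * σ₂, σ₂ * √(1 - ρ ^ 2)]).conjTranspose := by
    ext i j
    fin_cases i <;> fin_cases j <;>
      simp [covMatrix, Matrix.mul_apply, Fin.sum_univ_two]
    · ring
    · ring
    · ring
    · have := Real.mul_self_sqrt hρ
      linear_combination (-σ₂ ^ 2) * this
  rw [this]
  exact Matrix.posSemidef_self_mul_conjTranspose _

/-- The linear part is the Cholesky factor of the covariance matrix; the characteristic functions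
agree. -/
lemma multivariateGaussian_eq_map_prod (μ₁ μ₂ σ₁ σ₂ : ℝ) {ρ : ℝ} (h1 : -1 < ρ) (h2 : ρ < 1) :
    multivariateGaussian !₂[μ₁, μ₂] (covMatrix σ₁ σ₂ ρ) =
      ((gaussianReal 0 1).prod (gaussianReal 0 1)).map
        (fun p => !₂[μ₁ + σ₁ * p.1, μ₂ + (ρ * σ₂ * p.1 + σ₂ * √(1 - ρ ^ 2) * p.2)]) := by
  have hρ : 0 ≤ 1 - ρ ^ 2 := by nlinarith
  have hm : Measurable fun p : ℝ × ℝ => (!₂[μ₁ + σ₁ * p.1,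
      μ₂ + (ρ * σ₂ * p.1 + σ₂ * √(1 - ρ ^ 2) * p.2)] : EuclideanSpace ℝ (Fin 2)) := by
    refine (PiLp.continuous_toLp 2 _).measurable.comp (measurable_pi_lambda _ fun i => ?_)
    fin_cases i <;> simp <;> fun_prop
  have := Measure.isProbabilityMeasure_map
    (μ := (gaussianReal 0 1).prod (gaussianReal 0 1)) hm.aemeasurable
  refine Measure.ext_of_charFun (funext fun t => ?_)
  rw [charFun_multivariateGaussian (covMatrix_posSemidef σ₁ σ₂ h1 h2), charFun_apply,
    integral_map hm.aemeasurable (by fun_prop)]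
  have hsplit : ∀ p : ℝ × ℝ, Complex.exp ((inner ℝ (!₂[μ₁ + σ₁ * p.1,
      μ₂ + (ρ * σ₂ * p.1 + σ₂ * √(1 - ρ ^ 2) * p.2)] : EuclideanSpace ℝ (Fin 2)) t : ℝ) *
        Complex.I) =
      Complex.exp ((μ₁ * t 0 + μ₂ * t 1 : ℝ) * Complex.I) *
        (Complex.exp ((σ₁ * t 0 + ρ * σ₂ * t 1 : ℝ) * p.1 * Complex.I) *
          Complex.exp ((σ₂ * √(1 - ρ ^ 2) * t 1 : ℝ) * p.2 * Complex.I)) := by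
    intro p
    rw [← Complex.exp_add, ← Complex.exp_add]
    congr 1
    simp [PiLp.inner_apply, Fin.sum_univ_two]
    ring
  simp_rw [hsplit]
  rw [integral_const_mul, integral_prod_mul
    (f := fun x : ℝ => Complex.exp ((σ₁ * t 0 + ρ * σ₂ * t 1 : ℝ) * x * Complex.I))
    (g := fun x : ℝ => Complex.exp ((σ₂ * √(1 - ρ ^ 2) * t 1 : ℝ) * x * Complex.I)),
    ← charFun_apply_real, ← charFun_apply_real, charFun_gaussianReal, charFun_gaussianReal,
    ← Complex.exp_add, ← Complex.exp_add]
  congr 1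
  have hsq : ((√(1 - ρ ^ 2) : ℝ) : ℂ) ^ 2 = 1 - ρ ^ 2 := by
    rw [← Complex.ofReal_pow, Real.sq_sqrt hρ]
    push_cast
    ring
  simp [PiLp.inner_apply, Fin.sum_univ_two, covMatrix, Matrix.mulVec, dotProduct]
  linear_combination (-(σ₂ : ℂ) ^ 2 * (t 1) ^ 2 / 2) * (-hsq)

/-- Two independent standard normal vectors. -/
noncomputable def stdNormalPair (n : ℕ) : Measure ((Fin n → ℝ) × (Fin n → ℝ)) :=
  (Measure.pi fun _ => gaussianReal 0 1).prod (Measure.pi fun _ => gaussianReal 0 1)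

instance (n : ℕ) : IsProbabilityMeasure (stdNormalPair n) := by
  unfold stdNormalPair; infer_instance

/-- The sample built from two standard normal vectors. -/
noncomputable def sampleOfNormal {n : ℕ} (μ₁ μ₂ σ₁ σ₂ ρ : ℝ) (p : (Fin n → ℝ) × (Fin n → ℝ)) :
    Sample n :=
  pairSample (fun k => μ₁ + σ₁ * p.1 k)
    (fun k => μ₂ + (ρ * σ₂ * p.1 k + σ₂ * √(1 - ρ ^ 2) * p.2 k))

lemma measurable_sampleOfNormal {n : ℕ} (μ₁ μ₂ σ₁ σ₂ ρ : ℝ) :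
    Measurable (sampleOfNormal (n := n) μ₁ μ₂ σ₁ σ₂ ρ) := by
  refine measurable_pi_lambda _ fun k => ?_
  refine (PiLp.continuous_toLp 2 _).measurable.comp (measurable_pi_lambda _ fun i => ?_)
  fin_cases i <;> simp <;> fun_prop

lemma samplingLaw_eq_map (n : ℕ) (μ₁ μ₂ σ₁ σ₂ : ℝ) {ρ : ℝ} (h1 : -1 < ρ) (h2 : ρ < 1) :
    samplingLaw n μ₁ μ₂ σ₁ σ₂ ρ =
      (stdNormalPair n).map (sampleOfNormal μ₁ μ₂ σ₁ σ₂ ρ) := by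
  have hm : Measurable fun p : ℝ × ℝ => (!₂[μ₁ + σ₁ * p.1,
      μ₂ + (ρ * σ₂ * p.1 + σ₂ * √(1 - ρ ^ 2) * p.2)] : EuclideanSpace ℝ (Fin 2)) := by
    refine (PiLp.continuous_toLp 2 _).measurable.comp (measurable_pi_lambda _ fun i => ?_)
    fin_cases i <;> simp <;> fun_prop
  have hmp := measurePreserving_arrowProdEquivProdArrow ℝ ℝ (Fin n)
    (fun _ => gaussianReal 0 1) (fun _ => gaussianReal 0 1)
  have := Measure.isProbabilityMeasure_map
    (μ := (gaussianReal 0 1).prod (gaussianReal 0 1)) hm.aemeasurable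
  rw [samplingLaw, multivariateGaussian_eq_map_prod μ₁ μ₂ σ₁ σ₂ h1 h2, stdNormalPair,
    ← hmp.map_eq, Measure.map_map (measurable_sampleOfNormal _ _ _ _ _) hmp.measurable,
    ← Measure.pi_map_pi (fun _ => hm.aemeasurable)]
  rfl

/-! ### Sums of squares, products and the residual -/

lemma sum_sub_mean_mul {n : ℕ} (hn : n ≠ 0) (x y : Fin n → ℝ) :
    ∑ k, (x k - (∑ j, x j) / n) * (y k - (∑ j, y j) / n) =
      ∑ k, x k * y k - (∑ k, x k) * (∑ k, y k) / n := by
  have hn' : (n : ℝ) ≠ 0 := by exact_mod_cast hn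
  simp only [sub_mul, mul_sub, Finset.sum_sub_distrib, ← Finset.mul_sum, ← Finset.sum_mul,
    Finset.sum_const, Finset.card_univ, Fintype.card_fin, nsmul_eq_mul]
  field_simp
  ring

lemma scatter_eq {n : ℕ} (hn : n ≠ 0) (X : Sample n) (i j : Fin 2) :
    scatter X i j = ∑ k, X k i * X k j - (∑ k, X k i) * (∑ k, X k j) / n :=
  sum_sub_mean_mul hn (fun k => X k i) (fun k => X k j)

/-- The residual sum of squares `s₂₂ (1 - r²)`. -/
noncomputable def residual {n : ℕ} (X : Sample n) : ℝ := scatter X 1 1 * (1 - sampleCorr X ^ 2)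

lemma scatter_self_nonneg {n : ℕ} (X : Sample n) (i : Fin 2) : 0 ≤ scatter X i i :=
  Finset.sum_nonneg fun _ _ => mul_self_nonneg _

lemma scatter_one_zero_of_scatter_one_one {n : ℕ} (X : Sample n) (h : scatter X 1 1 = 0) :
    scatter X 0 1 = 0 := by
  rw [scatter, Finset.sum_eq_zero_iff_of_nonneg fun _ _ => mul_self_nonneg _] at h
  refine Finset.sum_eq_zero fun k hk => ?_
  rw [mul_self_eq_zero.1 (h k hk), mul_zero]

lemma residual_eq {n : ℕ} (X : Sample n) (h : 0 < scatter X 0 0) :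
    residual X = scatter X 1 1 - scatter X 0 1 ^ 2 / scatter X 0 0 := by
  -- If s₂₂ = 0 then r is 0 by the convention for division, and s₁₂ = 0 too, so both sides vanish.
  rcases (scatter_self_nonneg X 1).eq_or_lt with h0 | h0
  · rw [residual, ← h0, scatter_one_zero_of_scatter_one_one X h0.symm]
    simp
  · rw [residual, sampleCorr, div_pow, Real.sq_sqrt (by positivity)]
    field_simp

lemma nondegenerate_of_residual_pos {n : ℕ} (X : Sample n) (h0 : 0 < scatter X 0 0)
    (h : 0 < residual X) : Nondegenerate X := by
  have h1 : 0 < scatter X 1 1 := by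
    refine (scatter_self_nonneg X 1).lt_of_ne fun h1 => ?_
    rw [residual, ← h1, zero_mul] at h
    exact lt_irrefl _ h
  refine ⟨h0, h1, ?_⟩
  rw [residual] at h
  have := (pos_iff_pos_of_mul_pos h).1 h1
  rw [← sq_lt_one_iff_abs_lt_one]
  linarith

lemma residual_pos_of_nondegenerate {n : ℕ} (X : Sample n) (h : Nondegenerate X) :
    0 < residual X := by
  have := (sq_lt_one_iff_abs_lt_one _).2 h.2.2
  exact mul_pos h.2.1 (by linarith)

lemma dev_sampleOfNormal_zero {n : ℕ} (hn : n ≠ 0) (μ₁ μ₂ σ₁ σ₂ ρ : ℝ)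
    (p : (Fin n → ℝ) × (Fin n → ℝ)) (k : Fin n) :
    sampleOfNormal μ₁ μ₂ σ₁ σ₂ ρ p k 0 - sampleMean (sampleOfNormal μ₁ μ₂ σ₁ σ₂ ρ p) 0 =
      σ₁ * (pairSample p.1 p.2 k 0 - sampleMean (pairSample p.1 p.2) 0) := by
  have hn' : (n : ℝ) ≠ 0 := by exact_mod_cast hn
  simp [sampleOfNormal, sampleMean, pairSample, Finset.sum_add_distrib, ← Finset.mul_sum]
  field_simp
  ring

lemma dev_sampleOfNormal_one {n : ℕ} (hn : n ≠ 0) (μ₁ μ₂ σ₁ σ₂ ρ : ℝ)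
    (p : (Fin n → ℝ) × (Fin n → ℝ)) (k : Fin n) :
    sampleOfNormal μ₁ μ₂ σ₁ σ₂ ρ p k 1 - sampleMean (sampleOfNormal μ₁ μ₂ σ₁ σ₂ ρ p) 1 =
      ρ * σ₂ * (pairSample p.1 p.2 k 0 - sampleMean (pairSample p.1 p.2) 0) +
      σ₂ * √(1 - ρ ^ 2) * (pairSample p.1 p.2 k 1 - sampleMean (pairSample p.1 p.2) 1) := by
  have hn' : (n : ℝ) ≠ 0 := by exact_mod_cast hn
  simp [sampleOfNormal, sampleMean, pairSample, Finset.sum_add_distrib, ← Finset.mul_sum]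
  field_simp
  ring

lemma scatter_zero_zero_sampleOfNormal {n : ℕ} (hn : n ≠ 0) (μ₁ μ₂ σ₁ σ₂ ρ : ℝ)
    (p : (Fin n → ℝ) × (Fin n → ℝ)) :
    scatter (sampleOfNormal μ₁ μ₂ σ₁ σ₂ ρ p) 0 0 =
      σ₁ ^ 2 * scatter (pairSample p.1 p.2) 0 0 := by
  simp only [scatter, dev_sampleOfNormal_zero hn, Finset.mul_sum]
  exact Finset.sum_congr rfl fun k _ => by ring

lemma scatter_zero_one_sampleOfNormal {n : ℕ} (hn : n ≠ 0) (μ₁ μ₂ σ₁ σ₂ ρ : ℝ)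
    (p : (Fin n → ℝ) × (Fin n → ℝ)) :
    scatter (sampleOfNormal μ₁ μ₂ σ₁ σ₂ ρ p) 0 1 =
      σ₁ * (ρ * σ₂) * scatter (pairSample p.1 p.2) 0 0 +
      σ₁ * (σ₂ * √(1 - ρ ^ 2)) * scatter (pairSample p.1 p.2) 0 1 := by
  simp only [scatter, dev_sampleOfNormal_zero hn, dev_sampleOfNormal_one hn, Finset.mul_sum,
    ← Finset.sum_add_distrib]
  exact Finset.sum_congr rfl fun k _ => by ring

lemma scatter_one_one_sampleOfNormal {n : ℕ} (hn : n ≠ 0) (μ₁ μ₂ σ₁ σ₂ ρ : ℝ)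
    (p : (Fin n → ℝ) × (Fin n → ℝ)) :
    scatter (sampleOfNormal μ₁ μ₂ σ₁ σ₂ ρ p) 1 1 =
      (ρ * σ₂) ^ 2 * scatter (pairSample p.1 p.2) 0 0 +
      2 * (ρ * σ₂) * (σ₂ * √(1 - ρ ^ 2)) * scatter (pairSample p.1 p.2) 0 1 +
      (σ₂ * √(1 - ρ ^ 2)) ^ 2 * scatter (pairSample p.1 p.2) 1 1 := by
  simp only [scatter, dev_sampleOfNormal_one hn, Finset.mul_sum, ← Finset.sum_add_distrib]
  exact Finset.sum_congr rfl fun k _ => by ring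

/-- Regression removes the mean and the multiple of the first coordinate; only the independent
noise, scaled by σ₂√(1 - ρ²), is left. -/
lemma residual_sampleOfNormal {n : ℕ} (hn : n ≠ 0) (μ₁ μ₂ σ₂ : ℝ) {σ₁ ρ : ℝ} (hσ₁ : 0 < σ₁)
    (h1 : -1 < ρ) (h2 : ρ < 1) (p : (Fin n → ℝ) × (Fin n → ℝ))
    (hp : 0 < scatter (pairSample p.1 p.2) 0 0) :
    residual (sampleOfNormal μ₁ μ₂ σ₁ σ₂ ρ p) =
      condVar σ₂ ρ * residual (pairSample p.1 p.2) := by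
  have hρ : 0 ≤ 1 - ρ ^ 2 := by nlinarith
  have h0 : 0 < scatter (sampleOfNormal μ₁ μ₂ σ₁ σ₂ ρ p) 0 0 := by
    rw [scatter_zero_zero_sampleOfNormal hn]
    positivity
  rw [residual_eq _ h0, residual_eq _ hp, scatter_zero_zero_sampleOfNormal hn,
    scatter_zero_one_sampleOfNormal hn, scatter_one_one_sampleOfNormal hn, condVar]
  have hsq : √(1 - ρ ^ 2) ^ 2 = 1 - ρ ^ 2 := Real.sq_sqrt hρ
  field_simp
  ring_nf at hsq ⊢
  rw [hsq]
  ring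

/-! ### Chi-squared law of the residual by orthogonal projection -/

/-- Removing the components of a standard normal vector along `#s` orthonormal directions leaves
a vector whose squared length is chi-squared with `n - #s` degrees of freedom. -/
lemma map_residual_normSq_pi_gaussianReal {n : ℕ} (s : Finset (Fin n)) (hs : sᶜ.Nonempty)
    (v : Fin n → EuclideanSpace ℝ (Fin n)) (hv : Orthonormal ℝ ((s : Set (Fin n)).domRestrict v)) :
    (Measure.pi fun _ : Fin n => gaussianReal 0 1).map
      (fun w => ∑ k, w k ^ 2 - ∑ i ∈ s, (∑ k, v i k * w k) ^ 2) =
      chiSquared ((n : ℝ) - s.card) := by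
  -- The standard Gaussian has independent standard normal coordinates in any orthonormal basis. In
  -- one extending the given directions, the residual is the sum of squares over the complement of
  -- s.
  obtain ⟨b, hb⟩ := hv.exists_orthonormalBasis_extension_of_card_eq (by simp)
  set g : EuclideanSpace ℝ (Fin n) → ℝ :=
    fun w => ∑ k, w k ^ 2 - ∑ i ∈ s, (∑ k, v i k * w k) ^ 2 with hg
  have hgm : Measurable g := by fun_prop
  have hbm : Measurable fun x : Fin n → ℝ => ∑ i, x i • b i := by fun_prop
  have h1 : (fun w : Fin n → ℝ => ∑ k, w k ^ 2 - ∑ i ∈ s, (∑ k, v i k * w k) ^ 2) =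
      g ∘ WithLp.toLp 2 := rfl
  have h2 : g ∘ (fun x : Fin n → ℝ => ∑ i, x i • b i) = fun x => ∑ i ∈ sᶜ, x i ^ 2 := by
    funext x
    have hinner : ∀ j, inner ℝ (b j) (∑ i, x i • b i) = x j := by
      intro j
      simp [inner_sum, inner_smul_right, orthonormal_iff_ite.1 b.orthonormal]
    have hn : ∑ k, (∑ i, x i • b i : EuclideanSpace ℝ (Fin n)) k ^ 2 = ∑ i, x i ^ 2 := by
      rw [← EuclideanSpace.real_norm_sq_eq, ← b.sum_sq_inner_right]
      simp_rw [hinner]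
    have hi : ∀ i ∈ s, ∑ k, v i k * (∑ i, x i • b i : EuclideanSpace ℝ (Fin n)) k = x i := by
      intro i hi
      rw [← hinner i, hb i hi, PiLp.inner_apply]
      exact Finset.sum_congr rfl fun k _ => by simp [mul_comm]
    simp only [Function.comp_apply, hg]
    have hi' : ∑ i ∈ s, (∑ k, v i k * (∑ i, x i • b i : EuclideanSpace ℝ (Fin n)) k) ^ 2 =
        ∑ i ∈ s, x i ^ 2 := Finset.sum_congr rfl fun i his => by rw [hi i his]
    rw [hn, hi', ← Finset.sum_add_sum_compl s fun i => x i ^ 2]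
    ring
  have hcard : ((sᶜ.card : ℕ) : ℝ) = (n : ℝ) - s.card := by
    rw [Finset.card_compl, Nat.cast_sub s.card_le_univ, Fintype.card_fin]
  rw [h1, ← Measure.map_map hgm (by fun_prop), map_pi_eq_stdGaussian,
    stdGaussian_eq_map_pi_orthonormalBasis b, Measure.map_map hgm hbm, h2,
    map_sum_sq_pi_gaussianReal _ hs, hcard]

/-- The normalized constant vector. -/
noncomputable def unitConst (n : ℕ) : EuclideanSpace ℝ (Fin n) := WithLp.toLp 2 fun _ => (√n)⁻¹

/-- The normalized vector of deviations of the first coordinate from its mean. -/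
noncomputable def unitDev {n : ℕ} (X : Sample n) : EuclideanSpace ℝ (Fin n) :=
  WithLp.toLp 2 fun k => (X k 0 - sampleMean X 0) / √(scatter X 0 0)

lemma inner_unitConst_self {n : ℕ} (hn : n ≠ 0) : inner ℝ (unitConst n) (unitConst n) = 1 := by
  have hn' : (n : ℝ) ≠ 0 := by exact_mod_cast hn
  have : (√(n : ℝ)) ^ 2 = n := Real.sq_sqrt (by positivity)
  simp only [unitConst, PiLp.inner_apply, RCLike.inner_apply, conj_trivial, Finset.sum_const,
    Finset.card_univ, Fintype.card_fin, nsmul_eq_mul]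
  field_simp
  exact this.symm

lemma sum_dev_eq_zero {n : ℕ} (hn : n ≠ 0) (X : Sample n) (i : Fin 2) :
    ∑ k, (X k i - sampleMean X i) = 0 := by
  have hn' : (n : ℝ) ≠ 0 := by exact_mod_cast hn
  simp only [sampleMean, Finset.sum_sub_distrib, Finset.sum_const, Finset.card_univ,
    Fintype.card_fin, nsmul_eq_mul]
  field_simp
  ring

lemma inner_unitConst_unitDev {n : ℕ} (hn : n ≠ 0) (X : Sample n) :
    inner ℝ (unitConst n) (unitDev X) = 0 := by
  simp [unitConst, unitDev, PiLp.inner_apply, ← Finset.sum_mul, ← Finset.sum_div,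
    sum_dev_eq_zero hn]

lemma inner_unitDev_self {n : ℕ} (X : Sample n) (h : 0 < scatter X 0 0) :
    inner ℝ (unitDev X) (unitDev X) = 1 := by
  simp only [unitDev, PiLp.inner_apply, RCLike.inner_apply, conj_trivial, div_mul_div_comm,
    ← Finset.sum_div, Real.mul_self_sqrt h.le]
  exact div_self h.ne'

lemma sum_unitConst_mul {n : ℕ} (w : Fin n → ℝ) :
    (∑ k, unitConst n k * w k) ^ 2 = (∑ k, w k) ^ 2 / n := by
  simp only [unitConst, ← Finset.mul_sum, mul_pow, inv_pow]
  rw [Real.sq_sqrt (by positivity)]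
  ring

/-- The deviations of the first coordinate sum to zero, so centring w changes nothing in the
product. -/
lemma sum_unitDev_mul {n : ℕ} (hn : n ≠ 0) (z w : Fin n → ℝ)
    (h : 0 < scatter (pairSample z w) 0 0) :
    (∑ k, unitDev (pairSample z w) k * w k) ^ 2 =
      scatter (pairSample z w) 0 1 ^ 2 / scatter (pairSample z w) 0 0 := by
  have h1 : scatter (pairSample z w) 0 1 =
      ∑ k, (pairSample z w k 0 - sampleMean (pairSample z w) 0) * w k := by
    simp only [scatter, mul_sub, Finset.sum_sub_distrib, ← Finset.sum_mul, sum_dev_eq_zero hn]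
    simp [pairSample]
  simp only [unitDev, div_mul_eq_mul_div, ← Finset.sum_div]
  rw [← h1, div_pow, Real.sq_sqrt h.le]

lemma scatter_pairSample_zero_zero {n : ℕ} (hn : n ≠ 0) (z w : Fin n → ℝ) :
    scatter (pairSample z w) 0 0 = ∑ k, z k ^ 2 - (∑ k, z k) ^ 2 / n := by
  rw [scatter_eq hn]
  simp [pairSample, pow_two]

lemma scatter_pairSample_one_one {n : ℕ} (hn : n ≠ 0) (z w : Fin n → ℝ) :
    scatter (pairSample z w) 1 1 = ∑ k, w k ^ 2 - (∑ k, w k) ^ 2 / n := by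
  rw [scatter_eq hn]
  simp [pairSample, pow_two]

lemma map_sumSq_dev_pi_gaussianReal {n : ℕ} (hn : 2 ≤ n) :
    (Measure.pi fun _ : Fin n => gaussianReal 0 1).map
      (fun z : Fin n → ℝ => ∑ k, z k ^ 2 - (∑ k, z k) ^ 2 / n) = chiSquared ((n : ℝ) - 1) := by
  have hn0 : n ≠ 0 := by omega
  let i₀ : Fin n := ⟨0, by omega⟩
  let i₁ : Fin n := ⟨1, by omega⟩
  have h01 : i₁ ≠ i₀ := by simp [i₀, i₁, Fin.ext_iff]
  have hv : Orthonormal ℝ ((({i₀} : Finset (Fin n)) : Set (Fin n)).domRestrict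
      fun _ => unitConst n) := by
    rw [orthonormal_iff_ite]
    rintro ⟨i, hi⟩ ⟨j, hj⟩
    simp only [Finset.coe_singleton, Set.mem_singleton_iff] at hi hj
    subst hi hj
    simpa using! inner_unitConst_self hn0
  have := map_residual_normSq_pi_gaussianReal {i₀} ⟨i₁, by simp [h01]⟩ (fun _ => unitConst n) hv
  simpa [sum_unitConst_mul] using! this

lemma map_residual_pi_gaussianReal {n : ℕ} (hn : 3 ≤ n) (z : Fin n → ℝ)
    (hz : ∀ w, 0 < scatter (pairSample z w) 0 0) :
    (Measure.pi fun _ : Fin n => gaussianReal 0 1).map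
      (fun w => residual (pairSample z w)) = chiSquared ((n : ℝ) - 2) := by
  have hn0 : n ≠ 0 := by omega
  let i₀ : Fin n := ⟨0, by omega⟩
  let i₁ : Fin n := ⟨1, by omega⟩
  -- This third index keeps the complement of the two removed directions nonempty; it needs n ≥ 3.
  let i₂ : Fin n := ⟨2, by omega⟩
  have h01 : i₁ ≠ i₀ := by simp [i₀, i₁, Fin.ext_iff]
  have h02 : i₂ ≠ i₀ := by simp [i₀, i₂, Fin.ext_iff]
  have h12 : i₂ ≠ i₁ := by simp [i₁, i₂, Fin.ext_iff]
  have hdev : ∀ w, unitDev (pairSample z w) = unitDev (pairSample z 0) := fun w => rfl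
  let v : Fin n → EuclideanSpace ℝ (Fin n) :=
    fun i => if i = i₀ then unitConst n else unitDev (pairSample z 0)
  have hv0 : v i₀ = unitConst n := by simp [v]
  have hv1 : v i₁ = unitDev (pairSample z 0) := by simp [v, h01]
  have hv : Orthonormal ℝ ((({i₀, i₁} : Finset (Fin n)) : Set (Fin n)).domRestrict v) := by
    rw [orthonormal_iff_ite]
    rintro ⟨i, hi⟩ ⟨j, hj⟩
    simp only [Finset.coe_insert, Finset.coe_singleton, Set.mem_insert_iff,
      Set.mem_singleton_iff] at hi hj
    simp only [Set.domRestrict_apply, Subtype.mk.injEq]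
    rcases hi with rfl | rfl <;> rcases hj with rfl | rfl
    · rw [hv0, inner_unitConst_self hn0, if_pos rfl]
    · simp [hv0, hv1, inner_unitConst_unitDev hn0, h01.symm]
    · rw [real_inner_comm]
      simp [hv0, hv1, inner_unitConst_unitDev hn0, h01]
    · rw [hv1, inner_unitDev_self _ (hz 0), if_pos rfl]
  have hmain := map_residual_normSq_pi_gaussianReal {i₀, i₁}
    ⟨i₂, by simp [h02, h12]⟩ v hv
  rw [Finset.card_pair h01.symm] at hmain
  have hfun : (fun w : Fin n → ℝ => residual (pairSample z w)) =
      fun w => ∑ k, w k ^ 2 - ∑ i ∈ {i₀, i₁}, (∑ k, v i k * w k) ^ 2 := by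
    funext w
    rw [Finset.sum_pair h01.symm, hv0, hv1, sum_unitConst_mul, ← hdev w,
      sum_unitDev_mul hn0 z w (hz w), residual_eq _ (hz w), scatter_pairSample_one_one hn0]
    ring
  rw [hfun, hmain]
  norm_num

lemma measurable_scatter {n : ℕ} (i j : Fin 2) : Measurable fun X : Sample n => scatter X i j := by
  unfold scatter sampleMean
  fun_prop

lemma measurable_residual {n : ℕ} : Measurable (residual (n := n)) := by
  unfold residual sampleCorr
  have := measurable_scatter (n := n)
  fun_prop

lemma measurable_pairSample {n : ℕ} :
    Measurable fun p : (Fin n → ℝ) × (Fin n → ℝ) => pairSample p.1 p.2 := by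
  refine measurable_pi_lambda _ fun k => ?_
  refine (PiLp.continuous_toLp 2 _).measurable.comp (measurable_pi_lambda _ fun i => ?_)
  fin_cases i <;> simp <;> fun_prop

lemma ae_scatter_pos_pi_gaussianReal {n : ℕ} (hn : 2 ≤ n) :
    ∀ᵐ z ∂(Measure.pi fun _ : Fin n => gaussianReal 0 1),
      ∀ w, 0 < scatter (pairSample z w) 0 0 := by
  have hn0 : n ≠ 0 := by omega
  have hn2 : (2 : ℝ) ≤ n := by exact_mod_cast hn
  have h0 := (isPositiveDiffuse_chiSquared (k := (n : ℝ) - 1) (by linarith)).Iic_zero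
  rw [← map_sumSq_dev_pi_gaussianReal hn, Measure.map_apply (by fun_prop) measurableSet_Iic] at h0
  filter_upwards [measure_eq_zero_iff_ae_notMem.1 h0] with z hz w
  rw [scatter_pairSample_zero_zero hn0]
  simpa using hz

lemma ae_stdNormalPair_scatter_pos {n : ℕ} (hn : 2 ≤ n) :
    ∀ᵐ p ∂(stdNormalPair n), 0 < scatter (pairSample p.1 p.2) 0 0 := by
  have h := (Measure.quasiMeasurePreserving_fst
    (μ := Measure.pi fun _ : Fin n => gaussianReal 0 1)
    (ν := Measure.pi fun _ : Fin n => gaussianReal 0 1)).ae (ae_scatter_pos_pi_gaussianReal hn)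
  filter_upwards [h] with p hp using hp p.2

/-- For almost every z the conditional law of the residual is the same chi-squared law, so by Fubini
it is also the unconditional law. -/
lemma map_residual_stdNormalPair {n : ℕ} (hn : 3 ≤ n) :
    (stdNormalPair n).map (fun p => residual (pairSample p.1 p.2)) =
      chiSquared ((n : ℝ) - 2) := by
  have hm : Measurable fun p : (Fin n → ℝ) × (Fin n → ℝ) => residual (pairSample p.1 p.2) :=
    measurable_residual.comp measurable_pairSample
  ext s hs
  rw [Measure.map_apply hm hs, stdNormalPair, Measure.prod_apply (hm hs)]
  have : ∀ᵐ z ∂(Measure.pi fun _ : Fin n => gaussianReal 0 1),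
      (Measure.pi fun _ : Fin n => gaussianReal 0 1)
        (Prod.mk z ⁻¹' ((fun p => residual (pairSample p.1 p.2)) ⁻¹' s)) =
      chiSquared ((n : ℝ) - 2) s := by
    filter_upwards [ae_scatter_pos_pi_gaussianReal (by omega : 2 ≤ n)] with z hz
    have hmz : Measurable fun w => residual (pairSample z w) :=
      measurable_residual.comp (measurable_pairSample.comp measurable_prodMk_left)
    rw [← map_residual_pi_gaussianReal hn z hz, Measure.map_apply hmz hs,
      ← Set.preimage_comp]
    rfl
  rw [lintegral_congr_ae this, lintegral_const, measure_univ, mul_one]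

lemma condVar_pos {σ₂ ρ : ℝ} (hσ₂ : 0 < σ₂) (h1 : -1 < ρ) (h2 : ρ < 1) : 0 < condVar σ₂ ρ := by
  have : 0 < 1 - ρ ^ 2 := by nlinarith
  exact mul_pos (by positivity) this

/-- Under the sampling law, `s₂₂ (1 - r²) / θ₂` is chi-squared with `n - 2` degrees of freedom. -/
lemma map_residual_div_condVar_samplingLaw {n : ℕ} (hn : 3 ≤ n) (μ₁ μ₂ : ℝ) {σ₁ σ₂ ρ : ℝ}
    (hσ₁ : 0 < σ₁) (hσ₂ : 0 < σ₂) (h1 : -1 < ρ) (h2 : ρ < 1) :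
    (samplingLaw n μ₁ μ₂ σ₁ σ₂ ρ).map (fun X => residual X / condVar σ₂ ρ) =
      chiSquared ((n : ℝ) - 2) := by
  rw [samplingLaw_eq_map n μ₁ μ₂ σ₁ σ₂ h1 h2, Measure.map_map (measurable_residual.div_const _)
    (measurable_sampleOfNormal _ _ _ _ _), ← map_residual_stdNormalPair hn]
  refine Measure.map_congr ?_
  filter_upwards [ae_stdNormalPair_scatter_pos (by omega : 2 ≤ n)] with p hp
  have := condVar_pos hσ₂ h1 h2
  rw [Function.comp_apply, residual_sampleOfNormal (by omega) μ₁ μ₂ σ₂ hσ₁ h1 h2 p hp]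
  field_simp

/-- The posterior is computed only for nondegenerate samples; this makes the others irrelevant to
coverage. -/
lemma ae_samplingLaw_nondegenerate {n : ℕ} (hn : 3 ≤ n) (μ₁ μ₂ : ℝ) {σ₁ σ₂ ρ : ℝ}
    (hσ₁ : 0 < σ₁) (hσ₂ : 0 < σ₂) (h1 : -1 < ρ) (h2 : ρ < 1) :
    ∀ᵐ X ∂(samplingLaw n μ₁ μ₂ σ₁ σ₂ ρ), Nondegenerate X := by
  have hn3 : (3 : ℝ) ≤ n := by exact_mod_cast hn
  have hθ := condVar_pos hσ₂ h1 h2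
  have hA : ∀ᵐ X ∂(samplingLaw n μ₁ μ₂ σ₁ σ₂ ρ), 0 < residual X := by
    have h0 := (isPositiveDiffuse_chiSquared (k := (n : ℝ) - 2) (by linarith)).Iic_zero
    rw [← map_residual_div_condVar_samplingLaw hn μ₁ μ₂ hσ₁ hσ₂ h1 h2,
      Measure.map_apply (measurable_residual.div_const _) measurableSet_Iic] at h0
    filter_upwards [measure_eq_zero_iff_ae_notMem.1 h0] with X hX
    by_contra hX'
    exact hX (div_nonpos_of_nonpos_of_nonneg (not_lt.1 hX') hθ.le)
  have hB : ∀ᵐ X ∂(samplingLaw n μ₁ μ₂ σ₁ σ₂ ρ), 0 < scatter X 0 0 := by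
    rw [samplingLaw_eq_map n μ₁ μ₂ σ₁ σ₂ h1 h2,
      ae_map_iff (measurable_sampleOfNormal _ _ _ _ _).aemeasurable
        (measurableSet_lt measurable_const (measurable_scatter 0 0))]
    filter_upwards [ae_stdNormalPair_scatter_pos (by omega : 2 ≤ n)] with p hp
    rw [scatter_zero_zero_sampleOfNormal (by omega)]
    positivity
  filter_upwards [hA, hB] with X hX hX'
  exact nondegenerate_of_residual_pos X hX' hX

/-! ### The likelihood in regression form -/

lemma normalDensity_eq {μ₁ μ₂ σ₁ σ₂ ρ : ℝ} (hσ₁ : 0 < σ₁) (hσ₂ : 0 < σ₂) (h1 : -1 < ρ)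
    (h2 : ρ < 1) (x : EuclideanSpace ℝ (Fin 2)) :
    normalDensity μ₁ μ₂ σ₁ σ₂ ρ x = ((2 * Real.pi)⁻¹ * (σ₁ * √(condVar σ₂ ρ))⁻¹) *
      Real.exp (-(1 / 2) * ((x 0 - μ₁) ^ 2 / σ₁ ^ 2 +
        (x 1 - μ₂ - ρ * σ₂ / σ₁ * (x 0 - μ₁)) ^ 2 / condVar σ₂ ρ)) := by
  have hρ : 0 < 1 - ρ ^ 2 := by nlinarith
  have hdet : (covMatrix σ₁ σ₂ ρ).det = σ₁ ^ 2 * condVar σ₂ ρ := by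
    simp [covMatrix, Matrix.det_fin_two, condVar]
    ring
  have hsqrt : √((covMatrix σ₁ σ₂ ρ).det) = σ₁ * √(condVar σ₂ ρ) := by
    rw [hdet, Real.sqrt_mul (by positivity), Real.sqrt_sq hσ₁.le]
  rw [normalDensity, hsqrt]
  congr 3
  rw [Matrix.inv_def, hdet, Ring.inverse_eq_inv', Matrix.adjugate_fin_two]
  simp [covMatrix, Matrix.mulVec, dotProduct, Fin.sum_univ_two, condVar]
  field_simp
  ring

lemma sum_dev_sq {n : ℕ} (hn : n ≠ 0) (X : Sample n) (μ₁ : ℝ) :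
    ∑ k, (X k 0 - μ₁) ^ 2 = scatter X 0 0 + n * (μ₁ - sampleMean X 0) ^ 2 := by
  have hd := sum_dev_eq_zero hn X 0
  have : ∀ k, (X k 0 - μ₁) ^ 2 = (X k 0 - sampleMean X 0) * (X k 0 - sampleMean X 0) +
      2 * (sampleMean X 0 - μ₁) * (X k 0 - sampleMean X 0) + (μ₁ - sampleMean X 0) ^ 2 := by
    intro k; ring
  simp only [this, Finset.sum_add_distrib, ← Finset.mul_sum, hd, Finset.sum_const,
    Finset.card_univ, Fintype.card_fin, nsmul_eq_mul, scatter]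
  ring

lemma sum_regression_sq {n : ℕ} (hn : n ≠ 0) (X : Sample n) (μ₁ μ₂ β : ℝ) :
    ∑ k, (X k 1 - μ₂ - β * (X k 0 - μ₁)) ^ 2 =
      scatter X 1 1 - 2 * β * scatter X 0 1 + β ^ 2 * scatter X 0 0 +
        n * (μ₂ - (sampleMean X 1 - β * (sampleMean X 0 - μ₁))) ^ 2 := by
  have hd0 := sum_dev_eq_zero hn X 0
  have hd1 := sum_dev_eq_zero hn X 1
  set c : ℝ := sampleMean X 1 - μ₂ - β * (sampleMean X 0 - μ₁) with hc
  have : ∀ k, (X k 1 - μ₂ - β * (X k 0 - μ₁)) ^ 2 =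
      (X k 1 - sampleMean X 1) * (X k 1 - sampleMean X 1) -
      2 * β * ((X k 0 - sampleMean X 0) * (X k 1 - sampleMean X 1)) +
      β ^ 2 * ((X k 0 - sampleMean X 0) * (X k 0 - sampleMean X 0)) +
      2 * c * (X k 1 - sampleMean X 1) - 2 * c * β * (X k 0 - sampleMean X 0) + c ^ 2 := by
    intro k; rw [hc]; ring
  simp only [this, Finset.sum_add_distrib, Finset.sum_sub_distrib, ← Finset.mul_sum, hd0, hd1,
    Finset.sum_const, Finset.card_univ, Fintype.card_fin, nsmul_eq_mul]
  simp only [scatter, hc]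
  ring

/-- Completing the square in μ₁, in μ₂ and in the slope ρσ₂/σ₁ isolates Gaussian factors to be
integrated out in turn. -/
lemma likelihood_eq {n : ℕ} (hn : n ≠ 0) (X : Sample n) (hs : 0 < scatter X 0 0)
    {μ₁ μ₂ σ₁ σ₂ ρ : ℝ} (hσ₁ : 0 < σ₁) (hσ₂ : 0 < σ₂) (h1 : -1 < ρ) (h2 : ρ < 1) :
    likelihood X μ₁ μ₂ σ₁ σ₂ ρ = ((2 * Real.pi)⁻¹ * (σ₁ * √(condVar σ₂ ρ))⁻¹) ^ n *
      Real.exp (-(1 / 2) * (scatter X 0 0 / σ₁ ^ 2 + (residual X + scatter X 0 0 *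
        (ρ * σ₂ / σ₁ - scatter X 0 1 / scatter X 0 0) ^ 2) / condVar σ₂ ρ)) *
      (Real.exp (-(n / (2 * σ₁ ^ 2)) * (μ₁ - sampleMean X 0) ^ 2) *
        Real.exp (-(n / (2 * condVar σ₂ ρ)) *
          (μ₂ - (sampleMean X 1 - ρ * σ₂ / σ₁ * (sampleMean X 0 - μ₁))) ^ 2)) := by
  simp only [likelihood, normalDensity_eq hσ₁ hσ₂ h1 h2]
  rw [Finset.prod_mul_distrib, Finset.prod_const, Finset.card_univ, Fintype.card_fin,
    ← Real.exp_sum, ← Finset.mul_sum, Finset.sum_add_distrib, ← Finset.sum_div, ← Finset.sum_div,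
    sum_dev_sq hn, sum_regression_sq hn, residual_eq X hs, ← Real.exp_add,
    mul_assoc (_ ^ n), ← Real.exp_add]
  congr 2
  have := condVar_pos hσ₂ h1 h2
  field_simp
  ring

/-! ### Gaussian integrals and changes of variables -/

lemma lintegral_exp_neg_mul_sub_sq {u : ℝ} (hu : 0 < u) (c : ℝ) :
    ∫⁻ x : ℝ, ENNReal.ofReal (Real.exp (-u * (x - c) ^ 2)) = ENNReal.ofReal √(Real.pi / u) := by
  rw [lintegral_sub_right_eq_self (fun x : ℝ => ENNReal.ofReal (Real.exp (-u * x ^ 2))) c,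
    ← integral_gaussian, ofReal_integral_eq_lintegral_ofReal (integrable_exp_neg_mul_sq hu)]
  exact Filter.Eventually.of_forall fun _ => (Real.exp_pos _).le

lemma lintegral_means {A u v : ℝ} (hA : 0 ≤ A) (hu : 0 < u) (hv : 0 < v) (c : ℝ) (d : ℝ → ℝ) :
    ∫⁻ μ₁ : ℝ, ∫⁻ μ₂ : ℝ, ENNReal.ofReal (A * (Real.exp (-u * (μ₁ - c) ^ 2) *
      Real.exp (-v * (μ₂ - d μ₁) ^ 2))) =
      ENNReal.ofReal (A * (√(Real.pi / u) * √(Real.pi / v))) := by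
  have h1 : ∀ μ₁ : ℝ, ∫⁻ μ₂ : ℝ, ENNReal.ofReal (A * (Real.exp (-u * (μ₁ - c) ^ 2) *
      Real.exp (-v * (μ₂ - d μ₁) ^ 2))) =
      ENNReal.ofReal (A * √(Real.pi / v)) * ENNReal.ofReal (Real.exp (-u * (μ₁ - c) ^ 2)) := by
    intro μ₁
    have : ∀ μ₂ : ℝ, ENNReal.ofReal (A * (Real.exp (-u * (μ₁ - c) ^ 2) *
        Real.exp (-v * (μ₂ - d μ₁) ^ 2))) =
        ENNReal.ofReal (A * Real.exp (-u * (μ₁ - c) ^ 2)) *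
          ENNReal.ofReal (Real.exp (-v * (μ₂ - d μ₁) ^ 2)) := by
      intro μ₂
      rw [← ENNReal.ofReal_mul (by positivity), mul_assoc]
    simp_rw [this]
    rw [lintegral_const_mul' _ _ ENNReal.ofReal_ne_top, lintegral_exp_neg_mul_sub_sq hv,
      ← ENNReal.ofReal_mul (by positivity), ← ENNReal.ofReal_mul (by positivity)]
    ring_nf
  simp_rw [h1]
  rw [lintegral_const_mul' _ _ ENNReal.ofReal_ne_top, lintegral_exp_neg_mul_sub_sq hu,
    ← ENNReal.ofReal_mul (by positivity)]
  ring_nf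

/-- Substitution `β = c ρ / √(1 - ρ²)`. -/
lemma lintegral_eq_lintegral_div_sqrt {c : ℝ} (hc : 0 < c) (g : ℝ → ℝ≥0∞) :
    ∫⁻ β, g β = ∫⁻ ρ in Set.Ioo (-1 : ℝ) 1,
      ENNReal.ofReal (c / √(1 - ρ ^ 2) ^ 3) * g (c * (ρ / √(1 - ρ ^ 2))) := by
  have hpos : ∀ ρ ∈ Set.Ioo (-1 : ℝ) 1, 0 < 1 - ρ ^ 2 := fun ρ hρ => by nlinarith [hρ.1, hρ.2]
  have hderiv : ∀ ρ ∈ Set.Ioo (-1 : ℝ) 1,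
      HasDerivWithinAt (fun ρ : ℝ => c * (ρ / √(1 - ρ ^ 2))) (c / √(1 - ρ ^ 2) ^ 3)
        (Set.Ioo (-1 : ℝ) 1) ρ := by
    intro ρ hρ
    have h0 := hpos ρ hρ
    have hs : √(1 - ρ ^ 2) ≠ 0 := (Real.sqrt_pos.2 h0).ne'
    have hin : HasDerivAt (fun ρ : ℝ => 1 - ρ ^ 2) (-(2 * ρ)) ρ := by
      simpa using (hasDerivAt_pow 2 ρ).const_sub 1
    have := (((hasDerivAt_id ρ).div (hin.sqrt h0.ne') hs).const_mul c).hasDerivWithinAt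
      (s := Set.Ioo (-1 : ℝ) 1)
    refine this.congr_deriv ?_
    have hsq := Real.sq_sqrt h0.le
    simp only [id]
    field_simp
    rw [hsq]
    ring
  have hleft : Set.LeftInvOn (fun u : ℝ => u / c / √(1 + (u / c) ^ 2))
      (fun ρ : ℝ => c * (ρ / √(1 - ρ ^ 2))) (Set.Ioo (-1 : ℝ) 1) := by
    intro ρ hρ
    have h0 := hpos ρ hρ
    have hs := Real.sqrt_pos.2 h0
    have hsq := Real.sq_sqrt h0.le
    have h1 : 1 + (ρ / √(1 - ρ ^ 2)) ^ 2 = (√(1 - ρ ^ 2))⁻¹ ^ 2 := by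
      field_simp
      rw [hsq]
      ring
    simp only [mul_div_cancel_left₀ _ hc.ne']
    rw [h1, Real.sqrt_sq (by positivity)]
    field_simp
  have himage : (fun ρ : ℝ => c * (ρ / √(1 - ρ ^ 2))) '' Set.Ioo (-1 : ℝ) 1 = Set.univ := by
    refine Set.eq_univ_of_forall fun β => ?_
    set u : ℝ := β / c with hu
    have hp : 0 < 1 + u ^ 2 := by positivity
    have hsp := Real.sqrt_pos.2 hp
    have hsq := Real.sq_sqrt hp.le
    have h1 : 1 - (u / √(1 + u ^ 2)) ^ 2 = (√(1 + u ^ 2))⁻¹ ^ 2 := by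
      field_simp
      rw [hsq]
      ring
    refine ⟨u / √(1 + u ^ 2), ?_, ?_⟩
    · rw [Set.mem_Ioo, ← abs_lt, ← sq_lt_one_iff_abs_lt_one]
      have : 0 < (√(1 + u ^ 2))⁻¹ ^ 2 := by positivity
      linarith
    · simp only
      rw [h1, Real.sqrt_sq (by positivity), hu]
      field_simp
  rw [← setLIntegral_univ, ← himage,
    lintegral_image_eq_lintegral_abs_deriv_mul measurableSet_Ioo hderiv hleft.injOn]
  refine setLIntegral_congr_fun measurableSet_Ioo fun ρ hρ => ?_
  rw [abs_of_pos]
  have := Real.sqrt_pos.2 (hpos ρ hρ)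
  positivity

/-- Substitution `θ = d σ²`. -/
lemma lintegral_Ioi_eq_lintegral_sq_mul {d : ℝ} (hd : 0 < d) (g : ℝ → ℝ≥0∞) :
    ∫⁻ θ in Set.Ioi (0 : ℝ), g θ =
      ∫⁻ σ in Set.Ioi (0 : ℝ), ENNReal.ofReal (2 * σ * d) * g (σ ^ 2 * d) := by
  have hderiv : ∀ σ ∈ Set.Ioi (0 : ℝ),
      HasDerivWithinAt (fun σ : ℝ => σ ^ 2 * d) (2 * σ * d) (Set.Ioi 0) σ := by
    intro σ _
    simpa using ((hasDerivAt_pow 2 σ).mul_const d).hasDerivWithinAt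
  have hinj : Set.InjOn (fun σ : ℝ => σ ^ 2 * d) (Set.Ioi 0) := by
    intro x hx y hy hxy
    have : x ^ 2 = y ^ 2 := mul_right_cancel₀ hd.ne' hxy
    exact (pow_left_inj₀ (le_of_lt hx) (le_of_lt hy) two_ne_zero).1 this
  have himage : (fun σ : ℝ => σ ^ 2 * d) '' Set.Ioi 0 = Set.Ioi 0 := by
    ext θ
    constructor
    · rintro ⟨σ, hσ, rfl⟩
      have : 0 < σ := hσ
      exact mul_pos (by positivity) hd
    · intro hθ
      have hθ' : 0 < θ := hθ
      refine ⟨√(θ / d), Real.sqrt_pos.2 (by positivity), ?_⟩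
      simp only
      rw [Real.sq_sqrt (by positivity)]
      field_simp
  conv_lhs => rw [← himage]
  rw [lintegral_image_eq_lintegral_abs_deriv_mul measurableSet_Ioi hderiv hinj]
  refine setLIntegral_congr_fun measurableSet_Ioi fun σ (hσ : 0 < σ) => ?_
  rw [abs_of_pos (by positivity)]

/-- Change of variables from `(σ₂, ρ)` to the conditional variance and the regression slope. -/
lemma lintegral_condVar_slope {s : ℝ} (hs : 0 < s) (H : ℝ → ℝ → ℝ≥0∞)
    (hH : Measurable (Function.uncurry H)) :
    ∫⁻ σ₂ in Set.Ioi (0 : ℝ), ∫⁻ ρ in Set.Ioo (-1 : ℝ) 1,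
      ENNReal.ofReal (2 * σ₂ ^ 2 / s) * H (condVar σ₂ ρ) (ρ * σ₂ / s) =
      ∫⁻ θ in Set.Ioi (0 : ℝ), ∫⁻ β, H θ β := by
  have h1 : ∫⁻ θ in Set.Ioi (0 : ℝ), ∫⁻ β, H θ β =
      ∫⁻ θ in Set.Ioi (0 : ℝ), ∫⁻ ρ in Set.Ioo (-1 : ℝ) 1,
        ENNReal.ofReal (√θ / s / √(1 - ρ ^ 2) ^ 3) * H θ (√θ / s * (ρ / √(1 - ρ ^ 2))) :=
    setLIntegral_congr_fun measurableSet_Ioi fun θ (hθ : 0 < θ) =>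
      lintegral_eq_lintegral_div_sqrt (div_pos (Real.sqrt_pos.2 hθ) hs) _
  have hm1 : Measurable (Function.uncurry fun θ ρ : ℝ =>
      ENNReal.ofReal (√θ / s / √(1 - ρ ^ 2) ^ 3) * H θ (√θ / s * (ρ / √(1 - ρ ^ 2)))) := by
    have : Measurable fun p : ℝ × ℝ => H p.1 (√p.1 / s * (p.2 / √(1 - p.2 ^ 2))) :=
      hH.comp (f := fun p : ℝ × ℝ => (p.1, √p.1 / s * (p.2 / √(1 - p.2 ^ 2)))) (by fun_prop)
    simp only [Function.uncurry_def]
    fun_prop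
  have hm2 : Measurable (Function.uncurry fun σ₂ ρ : ℝ =>
      ENNReal.ofReal (2 * σ₂ ^ 2 / s) * H (condVar σ₂ ρ) (ρ * σ₂ / s)) := by
    have : Measurable fun p : ℝ × ℝ => H (condVar p.1 p.2) (p.2 * p.1 / s) :=
      hH.comp (f := fun p : ℝ × ℝ => (condVar p.1 p.2, p.2 * p.1 / s)) (by
        unfold condVar; fun_prop)
    exact Measurable.mul (by fun_prop) this
  -- With ρ outermost on both sides, the remaining substitution at fixed ρ is one-dimensional, θ =
  -- σ₂²(1 - ρ²). The two derivatives multiply to the Jacobian 2σ₂²/s.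
  rw [h1, lintegral_lintegral_swap hm1.aemeasurable, lintegral_lintegral_swap hm2.aemeasurable]
  refine setLIntegral_congr_fun measurableSet_Ioo fun ρ hρ => ?_
  have hd : 0 < 1 - ρ ^ 2 := by nlinarith [hρ.1, hρ.2]
  have hsd := Real.sqrt_pos.2 hd
  symm
  rw [lintegral_Ioi_eq_lintegral_sq_mul hd]
  refine setLIntegral_congr_fun measurableSet_Ioi fun σ (hσ : 0 < σ) => ?_
  have hsq : √(σ ^ 2 * (1 - ρ ^ 2)) = σ * √(1 - ρ ^ 2) := by
    rw [Real.sqrt_mul (by positivity), Real.sqrt_sq hσ.le]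
  rw [← mul_assoc, ← ENNReal.ofReal_mul (by positivity), hsq, condVar]
  congr 2
  · have h3 : √(1 - ρ ^ 2) ^ 3 = √(1 - ρ ^ 2) * (1 - ρ ^ 2) := by
      rw [pow_succ, Real.sq_sqrt hd.le, mul_comm]
    rw [h3]
    field_simp
  · field_simp

/-- Substitution `θ = S / y`. -/
lemma lintegral_Ioi_eq_lintegral_const_div {S : ℝ} (hS : 0 < S) (g : ℝ → ℝ≥0∞) :
    ∫⁻ θ in Set.Ioi (0 : ℝ), g θ =
      ∫⁻ y in Set.Ioi (0 : ℝ), ENNReal.ofReal (S / y ^ 2) * g (S / y) := by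
  have hderiv : ∀ y ∈ Set.Ioi (0 : ℝ),
      HasDerivWithinAt (fun y : ℝ => S / y) (-(S / y ^ 2)) (Set.Ioi 0) y := by
    intro y hy
    have := ((hasDerivAt_inv (ne_of_gt hy)).const_mul S).hasDerivWithinAt (s := Set.Ioi 0)
    simpa [div_eq_mul_inv] using this
  have hinj : Set.InjOn (fun y : ℝ => S / y) (Set.Ioi 0) := by
    intro x hx y hy hxy
    have hx' : x ≠ 0 := ne_of_gt hx
    have hy' : y ≠ 0 := ne_of_gt hy
    have h : S / x = S / y := hxy
    rw [← div_div_cancel₀ (b := x) hS.ne', h, div_div_cancel₀ hS.ne']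
  have himage : (fun y : ℝ => S / y) '' Set.Ioi 0 = Set.Ioi 0 := by
    ext θ
    constructor
    · rintro ⟨y, hy, rfl⟩
      exact div_pos hS hy
    · intro hθ
      exact ⟨S / θ, div_pos hS hθ, div_div_cancel₀ hS.ne'⟩
  conv_lhs => rw [← himage]
  rw [lintegral_image_eq_lintegral_abs_deriv_mul measurableSet_Ioi hderiv hinj]
  refine setLIntegral_congr_fun measurableSet_Ioi fun y (hy : 0 < y) => ?_
  rw [abs_neg, abs_of_pos (by positivity)]

lemma lintegral_chiSquared {k : ℝ} (f : ℝ → ℝ≥0∞) :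
    ∫⁻ y, f y ∂(chiSquared k) = ∫⁻ y in Set.Ioi (0 : ℝ), ENNReal.ofReal
      ((1 / 2) ^ (k / 2) / Real.Gamma (k / 2) * y ^ (k / 2 - 1) * Real.exp (-(1 / 2 * y))) *
        f y := by
  have hm : Measurable (gammaPDF (k / 2) (1 / 2)) :=
    (measurable_gammaPDFReal _ _).ennreal_ofReal
  rw [chiSquared, gammaMeasure, lintegral_withDensity_eq_lintegral_mul_non_measurable _ hm
    (Filter.Eventually.of_forall fun _ => ENNReal.ofReal_lt_top),
    ← lintegral_indicator measurableSet_Ioi]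
  refine lintegral_congr_ae ?_
  have h0 : ∀ᵐ y : ℝ, y ≠ 0 := by simp [ae_iff]
  filter_upwards [h0] with y hy
  rcases lt_or_gt_of_ne hy with h | h
  · rw [Set.indicator_of_notMem (by simpa using h.le), Pi.mul_apply, gammaPDF_of_neg h, zero_mul]
  · rw [Set.indicator_of_mem (by exact h), Pi.mul_apply, gammaPDF_of_nonneg h.le]

lemma lintegral_comp_div_chiSquared {S k : ℝ} (hS : 0 < S) (hk : 0 < k) (f : ℝ → ℝ≥0∞) :
    ∫⁻ θ in Set.Ioi (0 : ℝ), ENNReal.ofReal (θ ^ (-(k / 2) - 1) * Real.exp (-(S / (2 * θ)))) *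
      f θ = ENNReal.ofReal (S ^ (-(k / 2)) * Real.Gamma (k / 2) / (1 / 2) ^ (k / 2)) *
        ∫⁻ y, f (S / y) ∂(chiSquared k) := by
  have hΓ := Real.Gamma_pos_of_pos (half_pos hk)
  rw [lintegral_chiSquared, ← lintegral_const_mul' _ _ ENNReal.ofReal_ne_top,
    lintegral_Ioi_eq_lintegral_const_div hS]
  refine setLIntegral_congr_fun measurableSet_Ioi fun y (hy : 0 < y) => ?_
  rw [← mul_assoc, ← mul_assoc, ← ENNReal.ofReal_mul (by positivity),
    ← ENNReal.ofReal_mul (by positivity)]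
  congr 2
  have h1 : S / (2 * (S / y)) = 1 / 2 * y := by field_simp
  have h2 : (S / y) ^ (-(k / 2) - 1) = S ^ (-(k / 2)) * S⁻¹ * (y ^ (k / 2 - 1) * y ^ 2) := by
    rw [Real.div_rpow hS.le hy.le, Real.rpow_sub hS, Real.rpow_one,
      ← Real.rpow_natCast y 2, ← Real.rpow_add hy, div_eq_mul_inv, ← Real.rpow_neg hy.le]
    congr 2
    push_cast
    ring
  rw [h1, h2]
  field_simp

/-- The substitution σ = 1/y gives y^(c-1) exp(-s y²/2), integrable because c > 0. Used with c = n -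
a for the σ₁-integral. -/
lemma lintegral_rpow_mul_exp_neg_div_sq {c s : ℝ} (hc : 0 < c) (hs : 0 < s) :
    ∫⁻ σ in Set.Ioi (0 : ℝ), ENNReal.ofReal (σ ^ (-c - 1) * Real.exp (-(s / (2 * σ ^ 2)))) ≠ 0 ∧
    ∫⁻ σ in Set.Ioi (0 : ℝ), ENNReal.ofReal (σ ^ (-c - 1) * Real.exp (-(s / (2 * σ ^ 2)))) ≠ ∞ := by
  constructor
  · have hm : Measurable fun σ : ℝ =>
        ENNReal.ofReal (σ ^ (-c - 1) * Real.exp (-(s / (2 * σ ^ 2)))) := by fun_prop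
    refine (setLIntegral_pos_iff hm |>.2 ?_).ne'
    have : Set.Ioi (0 : ℝ) ⊆ (Function.support fun σ : ℝ =>
        ENNReal.ofReal (σ ^ (-c - 1) * Real.exp (-(s / (2 * σ ^ 2))))) ∩ Set.Ioi 0 := by
      intro σ hσ
      have hσ' : 0 < σ := hσ
      refine ⟨?_, hσ⟩
      rw [Function.mem_support, ne_eq, ENNReal.ofReal_eq_zero, not_le]
      positivity
    refine lt_of_lt_of_le ?_ (measure_mono this)
    simp
  · have hint := integrableOn_rpow_mul_exp_neg_mul_sq (half_pos hs) (s := c - 1) (by linarith)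
    rw [lintegral_Ioi_eq_lintegral_const_div one_pos]
    have : ∫⁻ y in Set.Ioi (0 : ℝ), ENNReal.ofReal (1 / y ^ 2) *
        ENNReal.ofReal ((1 / y) ^ (-c - 1) * Real.exp (-(s / (2 * (1 / y) ^ 2)))) =
        ∫⁻ y in Set.Ioi (0 : ℝ), ENNReal.ofReal (y ^ (c - 1) * Real.exp (-(s / 2) * y ^ 2)) := by
      refine setLIntegral_congr_fun measurableSet_Ioi fun y (hy : 0 < y) => ?_
      rw [← ENNReal.ofReal_mul (by positivity), ← mul_assoc]
      congr 2
      · rw [one_div, one_div, Real.inv_rpow hy.le, ← Real.rpow_neg hy.le, ← Real.rpow_natCast,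
          ← Real.rpow_neg hy.le, ← Real.rpow_add hy]
        congr 1
        push_cast
        ring
      · congr 1
        field_simp
    rw [this]
    exact hint.lintegral_lt_top.ne

/-! ### Integrating prior times likelihood -/

/-- The posterior weight of `(σ₁, θ, β)`, up to a factor depending on the sample size only. -/
lemma prior_mul_integrated_likelihood {n : ℕ} (hn : n ≠ 0) (a b s E : ℝ) {σ₁ σ₂ ρ : ℝ}
    (hσ₁ : 0 < σ₁) (hσ₂ : 0 < σ₂) (h1 : -1 < ρ) (h2 : ρ < 1) :
    priorDensity a b σ₁ σ₂ ρ * (((2 * Real.pi)⁻¹ * (σ₁ * √(condVar σ₂ ρ))⁻¹) ^ n *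
      Real.exp (-(1 / 2) * (s / σ₁ ^ 2 + E / condVar σ₂ ρ))) *
      (√(Real.pi / (n / (2 * σ₁ ^ 2))) * √(Real.pi / (n / (2 * condVar σ₂ ρ)))) =
    ((2 * Real.pi)⁻¹ ^ n * (Real.pi / n)) *
      (σ₁ ^ (-(n - a) - 1) * Real.exp (-(s / (2 * σ₁ ^ 2)))) *
      ((2 * σ₂ ^ 2 / σ₁) *
        (condVar σ₂ ρ ^ (-((n - b) / 2) - 3 / 2) * Real.exp (-(E / (2 * condVar σ₂ ρ))))) := by
  have hρ : 0 < 1 - ρ ^ 2 := by nlinarith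
  have hθ := condVar_pos hσ₂ h1 h2
  have hn' : 0 < (n : ℝ) := by exact_mod_cast Nat.pos_of_ne_zero hn
  have hπ := Real.pi_pos
  set θ := condVar σ₂ ρ with hθdef
  have hroots : √(Real.pi / (n / (2 * σ₁ ^ 2))) * √(Real.pi / (n / (2 * θ))) =
      (2 * (Real.pi / n)) * (σ₁ * √θ) := by
    rw [← Real.sqrt_mul (by positivity)]
    have : Real.pi / (n / (2 * σ₁ ^ 2)) * (Real.pi / (n / (2 * θ))) =
        (2 * (Real.pi / n) * σ₁) ^ 2 * θ := by
      field_simp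
    rw [this, Real.sqrt_mul (by positivity), Real.sqrt_sq (by positivity)]
    ring
  have hexp : Real.exp (-(1 / 2) * (s / σ₁ ^ 2 + E / θ)) =
      Real.exp (-(s / (2 * σ₁ ^ 2))) * Real.exp (-(E / (2 * θ))) := by
    rw [← Real.exp_add]
    congr 1
    field_simp
    ring
  -- Written with θ, the prior keeps a single factor σ₂², which goes into the Jacobian 2σ₂²/σ₁.
  have hprior : priorDensity a b σ₁ σ₂ ρ =
      σ₁ ^ (a - 3) * (σ₂ ^ 2 * θ ^ (b / 2 - 2)) := by
    have e1 : σ₁ ^ (a - 3) = (σ₁ ^ (3 - a))⁻¹ := by rw [← Real.rpow_neg hσ₁.le]; ring_nf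
    have e2 : σ₂ ^ 2 * (σ₂ ^ 2) ^ (b / 2 - 2) = (σ₂ ^ (2 - b))⁻¹ := by
      rw [← Real.rpow_neg hσ₂.le, ← Real.rpow_natCast, ← Real.rpow_mul hσ₂.le,
        ← Real.rpow_add hσ₂]
      congr 1
      push_cast
      ring
    have e3 : (1 - ρ ^ 2) ^ (b / 2 - 2) = ((1 - ρ ^ 2) ^ (2 - b / 2))⁻¹ := by
      rw [← Real.rpow_neg hρ.le]; ring_nf
    rw [hθdef, condVar, Real.mul_rpow (by positivity) hρ.le, ← mul_assoc, ← mul_assoc,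
      mul_assoc _ (σ₂ ^ 2), e1, e2, e3, priorDensity]
    field_simp
  have hσpow : σ₁ ^ (-(n - a) - 1) = σ₁ ^ (a - 3) * (σ₁⁻¹ ^ n * σ₁) * σ₁ := by
    rw [inv_pow, ← Real.rpow_natCast, ← Real.rpow_neg hσ₁.le]
    nth_rewrite 4 [← Real.rpow_one σ₁]
    nth_rewrite 5 [← Real.rpow_one σ₁]
    rw [← Real.rpow_add hσ₁, ← Real.rpow_add hσ₁, ← Real.rpow_add hσ₁]
    congr 1
    ring
  have hθpow : θ ^ (-((n - b) / 2) - 3 / 2) = θ ^ (b / 2 - 2) * ((√θ)⁻¹ ^ n * √θ) := by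
    rw [inv_pow, Real.sqrt_eq_rpow, ← Real.rpow_natCast, ← Real.rpow_mul hθ.le,
      ← Real.rpow_neg hθ.le, ← Real.rpow_add hθ, ← Real.rpow_add hθ]
    congr 1
    ring
  rw [hroots, hexp, hprior, hσpow, hθpow, mul_pow, mul_inv σ₁, mul_pow]
  generalize σ₁⁻¹ ^ n = u
  generalize (√θ)⁻¹ ^ n = v
  generalize (2 * Real.pi)⁻¹ ^ n = w
  field_simp

lemma measurableSet_paramSpace : MeasurableSet paramSpace := by
  have : paramSpace = Set.univ ×ˢ Set.univ ×ˢ Set.Ioi 0 ×ˢ Set.Ioi 0 ×ˢ Set.Ioo (-1) 1 := by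
    ext ⟨μ₁, μ₂, σ₁, σ₂, ρ⟩
    simp [paramSpace]
  rw [this]
  measurability

lemma restrict_paramSpace : (volume : Measure Param).restrict paramSpace =
    (volume : Measure ℝ).prod ((volume : Measure ℝ).prod ((volume.restrict (Set.Ioi 0)).prod
      ((volume.restrict (Set.Ioi 0)).prod (volume.restrict (Set.Ioo (-1) 1))))) := by
  have : paramSpace = Set.univ ×ˢ Set.univ ×ˢ Set.Ioi 0 ×ˢ Set.Ioi 0 ×ˢ Set.Ioo (-1) 1 := by
    ext ⟨μ₁, μ₂, σ₁, σ₂, ρ⟩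
    simp [paramSpace]
  rw [this]
  simp [Measure.volume_eq_prod, ← Measure.prod_restrict]

/-- Iterated integration over the parameter space, the means innermost. -/
lemma lintegral_paramSpace (F : Param → ℝ≥0∞) (hF : Measurable F) :
    ∫⁻ p in paramSpace, F p = ∫⁻ σ₁ in Set.Ioi (0 : ℝ), ∫⁻ σ₂ in Set.Ioi (0 : ℝ),
      ∫⁻ ρ in Set.Ioo (-1 : ℝ) 1, ∫⁻ μ₁ : ℝ, ∫⁻ μ₂ : ℝ, F (μ₁, μ₂, σ₁, σ₂, ρ) := by
  set ν : Measure (ℝ × ℝ × ℝ) := (volume.restrict (Set.Ioi 0)).prod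
      ((volume.restrict (Set.Ioi 0)).prod (volume.restrict (Set.Ioo (-1) 1))) with hν
  have h1 : Measurable fun r : ℝ × ℝ × ℝ × ℝ => ∫⁻ μ₁ : ℝ, F (μ₁, r) := hF.lintegral_prod_left'
  have h2 : Measurable fun t : ℝ × ℝ × ℝ => ∫⁻ μ₁ : ℝ, ∫⁻ μ₂ : ℝ, F (μ₁, μ₂, t) := by
    have : Measurable fun q : (ℝ × ℝ × ℝ) × ℝ => ∫⁻ μ₂ : ℝ, F (q.2, μ₂, q.1) := by
      refine Measurable.lintegral_prod_right' (f := fun u : ((ℝ × ℝ × ℝ) × ℝ) × ℝ =>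
        F (u.1.2, u.2, u.1.1)) (hF.comp (by fun_prop))
    exact this.lintegral_prod_right'
  rw [restrict_paramSpace, ← hν, lintegral_prod_symm' _ hF, lintegral_prod_symm' _ h1]
  have h3 : ∀ t : ℝ × ℝ × ℝ, ∫⁻ μ₂ : ℝ, ∫⁻ μ₁ : ℝ, F (μ₁, μ₂, t) =
      ∫⁻ μ₁ : ℝ, ∫⁻ μ₂ : ℝ, F (μ₁, μ₂, t) := by
    intro t
    exact lintegral_lintegral_swap (f := fun μ₂ μ₁ => F (μ₁, μ₂, t))
      (hF.comp (by fun_prop : Measurable fun q : ℝ × ℝ => (q.2, q.1, t))).aemeasurable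
  simp_rw [h3]
  rw [hν, lintegral_prod _ h2.aemeasurable]
  refine lintegral_congr fun σ₁ => ?_
  exact lintegral_prod (fun y : ℝ × ℝ => ∫⁻ μ₁ : ℝ, ∫⁻ μ₂ : ℝ, F (μ₁, μ₂, σ₁, y))
    (h2.comp measurable_prodMk_left).aemeasurable

/-- Prior times likelihood, with the likelihood in terms of the sufficient statistics. -/
noncomputable def posteriorWeight (a b : ℝ) {n : ℕ} (X : Sample n) (p : Param) : ℝ :=
  priorDensity a b p.2.2.1 p.2.2.2.1 p.2.2.2.2 *
    (((2 * Real.pi)⁻¹ * (p.2.2.1 * √(condVar p.2.2.2.1 p.2.2.2.2))⁻¹) ^ n *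
      Real.exp (-(1 / 2) * (scatter X 0 0 / p.2.2.1 ^ 2 + (residual X + scatter X 0 0 *
        (p.2.2.2.2 * p.2.2.2.1 / p.2.2.1 - scatter X 0 1 / scatter X 0 0) ^ 2) /
          condVar p.2.2.2.1 p.2.2.2.2))) *
    (Real.exp (-(n / (2 * p.2.2.1 ^ 2)) * (p.1 - sampleMean X 0) ^ 2) *
      Real.exp (-(n / (2 * condVar p.2.2.2.1 p.2.2.2.2)) *
        (p.2.1 - (sampleMean X 1 -
          p.2.2.2.2 * p.2.2.2.1 / p.2.2.1 * (sampleMean X 0 - p.1))) ^ 2))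

lemma measurable_posteriorWeight (a b : ℝ) {n : ℕ} (X : Sample n) :
    Measurable (posteriorWeight a b X) := by
  unfold posteriorWeight priorDensity condVar
  fun_prop

lemma unnormalizedPosterior_eq (a b : ℝ) {n : ℕ} (hn : n ≠ 0) (X : Sample n)
    (hs : 0 < scatter X 0 0) :
    unnormalizedPosterior a b X = ((volume : Measure Param).restrict paramSpace).withDensity
      fun p => ENNReal.ofReal (posteriorWeight a b X p) := by
  refine withDensity_congr_ae (ae_restrict_of_forall_mem measurableSet_paramSpace ?_)
  rintro ⟨μ₁, μ₂, σ₁, σ₂, ρ⟩ ⟨hσ₁, hσ₂, h1, h2⟩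
  simp only [posteriorWeight, likelihood_eq hn X hs hσ₁ hσ₂ h1 h2, mul_assoc]

/-- The Gaussian in β has variance θ/s; its integral supplies the √θ that turns the exponent -e -
3/2 into -e - 1. -/
lemma lintegral_slope {S s θ e : ℝ} (hs : 0 < s) (hθ : 0 < θ) (c : ℝ) :
    ∫⁻ β : ℝ, ENNReal.ofReal (θ ^ (-e - 3 / 2) *
      Real.exp (-((S + s * (β - c) ^ 2) / (2 * θ)))) =
      ENNReal.ofReal √(2 * Real.pi / s) *
        ENNReal.ofReal (θ ^ (-e - 1) * Real.exp (-(S / (2 * θ)))) := by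
  have h1 : ∀ β : ℝ, ENNReal.ofReal (θ ^ (-e - 3 / 2) *
      Real.exp (-((S + s * (β - c) ^ 2) / (2 * θ)))) =
      ENNReal.ofReal (θ ^ (-e - 3 / 2) * Real.exp (-(S / (2 * θ)))) *
        ENNReal.ofReal (Real.exp (-(s / (2 * θ)) * (β - c) ^ 2)) := by
    intro β
    rw [← ENNReal.ofReal_mul (by positivity), mul_assoc, ← Real.exp_add]
    congr 3
    field_simp
    ring
  simp_rw [h1]
  rw [lintegral_const_mul' _ _ ENNReal.ofReal_ne_top, lintegral_exp_neg_mul_sub_sq (by positivity),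
    ← ENNReal.ofReal_mul (by positivity), ← ENNReal.ofReal_mul (by positivity)]
  have h2 : √(Real.pi / (s / (2 * θ))) = √(2 * Real.pi / s) * √θ := by
    have := Real.pi_pos
    rw [← Real.sqrt_mul (by positivity)]
    congr 1
    field_simp
  have h3 : θ ^ (-e - 1) = θ ^ (-e - 3 / 2) * √θ := by
    rw [Real.sqrt_eq_rpow, ← Real.rpow_add hθ]
    congr 1
    ring
  rw [h2, h3]
  ring_nf

lemma lintegral_means_posteriorWeight (a b : ℝ) {n : ℕ} (hn : n ≠ 0) (X : Sample n)
    {σ₁ σ₂ ρ : ℝ} (hσ₁ : 0 < σ₁) (hσ₂ : 0 < σ₂) (h1 : -1 < ρ) (h2 : ρ < 1) :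
    ∫⁻ μ₁ : ℝ, ∫⁻ μ₂ : ℝ, ENNReal.ofReal (posteriorWeight a b X (μ₁, μ₂, σ₁, σ₂, ρ)) =
      ENNReal.ofReal (((2 * Real.pi)⁻¹ ^ n * (Real.pi / n)) *
        (σ₁ ^ (-(n - a) - 1) * Real.exp (-(scatter X 0 0 / (2 * σ₁ ^ 2))))) *
      (ENNReal.ofReal (2 * σ₂ ^ 2 / σ₁) *
        ENNReal.ofReal (condVar σ₂ ρ ^ (-((n - b) / 2) - 3 / 2) *
          Real.exp (-((residual X + scatter X 0 0 *
            (ρ * σ₂ / σ₁ - scatter X 0 1 / scatter X 0 0) ^ 2) / (2 * condVar σ₂ ρ))))) := by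
  have hθ := condVar_pos hσ₂ h1 h2
  have hρ : 0 < 1 - ρ ^ 2 := by nlinarith
  have hn' : 0 < (n : ℝ) := by exact_mod_cast Nat.pos_of_ne_zero hn
  have hπ := Real.pi_pos
  simp only [posteriorWeight]
  rw [lintegral_means (by unfold priorDensity; positivity) (by positivity) (by positivity),
    prior_mul_integrated_likelihood hn a b _ _ hσ₁ hσ₂ h1 h2, ENNReal.ofReal_mul (by positivity),
    ENNReal.ofReal_mul (p := 2 * σ₂ ^ 2 / σ₁) (by positivity)]

/-- Up to a finite nonzero factor, the conditional variance is distributed as `S / χ²` under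
prior times likelihood. -/
lemma exists_lintegral_unnormalizedPosterior {n : ℕ} (hn : n ≠ 0) {a b : ℝ} (ha : a < n)
    (hb : b < n) (X : Sample n) (hX : Nondegenerate X) :
    ∃ C : ℝ≥0∞, C ≠ 0 ∧ C ≠ ∞ ∧ ∀ f : ℝ → ℝ≥0∞, Measurable f → (∀ x, f x ≠ ∞) →
      ∫⁻ p, f (condVar p.2.2.2.1 p.2.2.2.2) ∂(unnormalizedPosterior a b X) =
        C * ∫⁻ y, f (residual X / y) ∂(chiSquared (n - b)) := by
  have hs := hX.1
  have hS := residual_pos_of_nondegenerate X hX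
  have hk : 0 < (n : ℝ) - b := by linarith
  have hn' : 0 < (n : ℝ) := by exact_mod_cast Nat.pos_of_ne_zero hn
  have hπ := Real.pi_pos
  have hΓ := Real.Gamma_pos_of_pos (half_pos hk)
  obtain ⟨hI0, hItop⟩ := lintegral_rpow_mul_exp_neg_div_sq (c := n - a) (by linarith) hs
  set s := scatter X 0 0 with hsdef
  set S := residual X with hSdef
  set w : ℝ := (2 * Real.pi)⁻¹ ^ n * (Real.pi / n) with hw
  have hwpos : 0 < w := by positivity
  set I := ∫⁻ σ in Set.Ioi (0 : ℝ),
    ENNReal.ofReal (σ ^ (-(n - a) - 1) * Real.exp (-(s / (2 * σ ^ 2)))) with hI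
  set D : ℝ := √(2 * Real.pi / s) with hD
  have hDpos : 0 < D := Real.sqrt_pos.2 (by positivity)
  set B : ℝ := S ^ (-((n - b) / 2)) * Real.Gamma ((n - b) / 2) / (1 / 2) ^ ((n - b) / 2) with hB
  have hBpos : 0 < B := by positivity
  refine ⟨ENNReal.ofReal w * I * (ENNReal.ofReal D * ENNReal.ofReal B), ?_, ?_, ?_⟩
  · simp [hI0, hwpos, hDpos, hBpos]
  · exact ENNReal.mul_ne_top (ENNReal.mul_ne_top ENNReal.ofReal_ne_top hItop)
      (ENNReal.mul_ne_top ENNReal.ofReal_ne_top ENNReal.ofReal_ne_top)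
  intro f hf hftop
  have hcm : Measurable fun p : Param => condVar p.2.2.2.1 p.2.2.2.2 := by
    unfold condVar; fun_prop
  have hwm := (measurable_posteriorWeight a b X).ennreal_ofReal
  have hfm : Measurable fun p : Param => f (condVar p.2.2.2.1 p.2.2.2.2) := hf.comp hcm
  set H : ℝ → ℝ → ℝ≥0∞ := fun θ β => f θ * ENNReal.ofReal (θ ^ (-((n - b) / 2) - 3 / 2) *
    Real.exp (-((S + s * (β - scatter X 0 1 / s) ^ 2) / (2 * θ)))) with hH
  have hHm : Measurable (Function.uncurry H) := by
    simp only [hH, Function.uncurry_def]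
    fun_prop
  have hJ : ∫⁻ θ in Set.Ioi (0 : ℝ), ∫⁻ β, H θ β =
      ENNReal.ofReal D * (ENNReal.ofReal B * ∫⁻ y, f (S / y) ∂(chiSquared (n - b))) := by
    rw [← lintegral_comp_div_chiSquared hS hk, ← lintegral_const_mul' _ _ ENNReal.ofReal_ne_top]
    refine setLIntegral_congr_fun measurableSet_Ioi fun θ (hθ : 0 < θ) => ?_
    simp only [hH]
    rw [lintegral_const_mul' _ _ (hftop θ), lintegral_slope hs hθ]
    ring
  rw [unnormalizedPosterior_eq a b hn X hs,
    lintegral_withDensity_eq_lintegral_mul _ hwm hfm, lintegral_paramSpace _ (hwm.mul hfm)]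
  -- For fixed σ₁ the slope ranges over all of ℝ, so integrating over (θ, β) leaves a factor free of
  -- σ₁; the σ₁-integral then separates.
  have hσ : ∀ σ₁ ∈ Set.Ioi (0 : ℝ), ∫⁻ σ₂ in Set.Ioi (0 : ℝ), ∫⁻ ρ in Set.Ioo (-1 : ℝ) 1,
      ∫⁻ μ₁ : ℝ, ∫⁻ μ₂ : ℝ, ((fun p => ENNReal.ofReal (posteriorWeight a b X p)) *
        fun p : Param => f (condVar p.2.2.2.1 p.2.2.2.2)) (μ₁, μ₂, σ₁, σ₂, ρ) =
      ENNReal.ofReal w * (ENNReal.ofReal (σ₁ ^ (-(n - a) - 1) * Real.exp (-(s / (2 * σ₁ ^ 2)))) *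
        (ENNReal.ofReal D * (ENNReal.ofReal B * ∫⁻ y, f (S / y) ∂(chiSquared (n - b))))) := by
    intro σ₁ hσ₁
    rw [← hJ, ← lintegral_condVar_slope hσ₁ H hHm, ← mul_assoc, ← ENNReal.ofReal_mul hwpos.le,
      ← lintegral_const_mul' _ _ ENNReal.ofReal_ne_top]
    refine setLIntegral_congr_fun measurableSet_Ioi fun σ₂ (hσ₂ : 0 < σ₂) => ?_
    rw [← lintegral_const_mul' _ _ ENNReal.ofReal_ne_top]
    refine setLIntegral_congr_fun measurableSet_Ioo fun ρ hρ => ?_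
    simp only [Pi.mul_apply]
    -- The value of f depends on (σ₂, ρ) alone and is finite, so it leaves the integrals over the
    -- means.
    simp_rw [lintegral_mul_const' _ _ (hftop _)]
    rw [lintegral_means_posteriorWeight a b hn X hσ₁ hσ₂ hρ.1 hρ.2]
    simp only [hH]
    ring
  rw [setLIntegral_congr_fun measurableSet_Ioi hσ,
    lintegral_const_mul' _ _ ENNReal.ofReal_ne_top, lintegral_mul_const _ (by fun_prop)]
  ring

/-- Testing with f = 1 identifies the total mass as C, nonzero and finite; testing with indicators
gives the law, and C cancels on normalizing. -/
lemma posterior_spec {n : ℕ} (hn : n ≠ 0) {a b : ℝ} (ha : a < n) (hb : b < n) (X : Sample n)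
    (hX : Nondegenerate X) :
    IsProbabilityMeasure (posterior a b X) ∧
      posteriorCondVar a b X = (chiSquared (n - b)).map fun y => residual X / y := by
  obtain ⟨C, hC0, hCtop, hC⟩ := exists_lintegral_unnormalizedPosterior hn ha hb X hX
  have := (isPositiveDiffuse_chiSquared (k := (n : ℝ) - b) (by linarith)).prob
  have hcm : Measurable fun p : Param => condVar p.2.2.2.1 p.2.2.2.2 := by
    unfold condVar; fun_prop
  have hm : Measurable fun y : ℝ => residual X / y := by fun_prop
  have huniv : unnormalizedPosterior a b X Set.univ = C := by
    simpa using hC (fun _ => 1) measurable_const (fun _ => ENNReal.one_ne_top)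
  refine ⟨⟨?_⟩, ?_⟩
  · rw [posterior, Measure.smul_apply, huniv, smul_eq_mul, ENNReal.inv_mul_cancel hC0 hCtop]
  · ext t ht
    have hset : unnormalizedPosterior a b X
        ((fun p : Param => condVar p.2.2.2.1 p.2.2.2.2) ⁻¹' t) =
        C * chiSquared (n - b) ((fun y => residual X / y) ⁻¹' t) := by
      have h := hC (t.indicator 1) (measurable_const.indicator ht) (fun x => by
        by_cases hx : x ∈ t <;> simp [hx])
      have h1 : ∀ p : Param, t.indicator (1 : ℝ → ℝ≥0∞) (condVar p.2.2.2.1 p.2.2.2.2) =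
          ((fun p : Param => condVar p.2.2.2.1 p.2.2.2.2) ⁻¹' t).indicator 1 p := fun _ => rfl
      have h2 : ∀ y : ℝ, t.indicator (1 : ℝ → ℝ≥0∞) (residual X / y) =
          ((fun y => residual X / y) ⁻¹' t).indicator 1 y := fun _ => rfl
      simp_rw [h1, h2] at h
      rwa [lintegral_indicator_one (hcm ht), lintegral_indicator_one (hm ht)] at h
    rw [posteriorCondVar, Measure.map_apply hm ht, Measure.map_apply hcm ht, posterior,
      Measure.smul_apply, huniv, smul_eq_mul, hset, ← mul_assoc,
      ENNReal.inv_mul_cancel hC0 hCtop, one_mul]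

/-! ### Coverage of the credible interval -/

lemma quantile_posteriorCondVar {n : ℕ} (hn : n ≠ 0) {a b α : ℝ} (ha : a < n) (hb : b < n)
    (hα0 : 0 < α) (hα1 : α < 1) (X : Sample n) (hX : Nondegenerate X) :
    quantile (posteriorCondVar a b X) (1 - α) =
      residual X / quantile (chiSquared (n - b)) α := by
  rw [(posterior_spec hn ha hb X hX).2]
  exact (isPositiveDiffuse_chiSquared (by linarith)).quantile_map_const_div
    (residual_pos_of_nondegenerate X hX) hα0 hα1

lemma coverage_eq {n : ℕ} (hn : 3 ≤ n) {a b α : ℝ} (ha : a < n) (hb : b < n) (hα0 : 0 < α)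
    (hα1 : α < 1) (μ₁ μ₂ : ℝ) {σ₁ σ₂ ρ : ℝ} (hσ₁ : 0 < σ₁) (hσ₂ : 0 < σ₂) (h1 : -1 < ρ)
    (h2 : ρ < 1) :
    coverage n a b α μ₁ μ₂ σ₁ σ₂ ρ =
      chiSquared (n - 2) (Set.Ioi (quantile (chiSquared (n - b)) α)) := by
  have hθ := condVar_pos hσ₂ h1 h2
  have hq := (isPositiveDiffuse_chiSquared (k := (n : ℝ) - b) (by linarith)).quantile_pos hα0 hα1
  rw [coverage, ← map_residual_div_condVar_samplingLaw hn μ₁ μ₂ hσ₁ hσ₂ h1 h2,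
    Measure.map_apply (measurable_residual.div_const _) measurableSet_Ioi]
  refine measure_congr ?_
  filter_upwards [ae_samplingLaw_nondegenerate hn μ₁ μ₂ hσ₁ hσ₂ h1 h2] with X hX
  apply propext
  change (0 < condVar σ₂ ρ ∧ condVar σ₂ ρ < quantile (posteriorCondVar a b X) (1 - α)) ↔
    quantile (chiSquared (n - b)) α < residual X / condVar σ₂ ρ
  rw [quantile_posteriorCondVar (by omega) ha hb hα0 hα1 X hX, lt_div_comm₀ hθ hq]
  simp [hθ]

end BivariateNormal

theorem theorem5 (n : ℕ) (hn : 3 ≤ n) (a b : ℝ) (ha : a < n) (hb : b < n) :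
    (∀ X : BivariateNormal.Sample n, BivariateNormal.Nondegenerate X →
      IsProbabilityMeasure (BivariateNormal.posterior a b X) ∧
      BivariateNormal.posteriorCondVar a b X =
        (BivariateNormal.chiSquared (n - b)).map
          (fun y => BivariateNormal.scatter X 1 1 *
            (1 - BivariateNormal.sampleCorr X ^ 2) / y) ∧
      ∀ α : ℝ, 0 < α → α < 1 → ∀ q : ℝ,
        (BivariateNormal.posteriorCondVar a b X (Set.Iio q) = ENNReal.ofReal (1 - α) ↔
          q = BivariateNormal.quantile (BivariateNormal.posteriorCondVar a b X) (1 - α))) ∧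
    (∀ α : ℝ, 0 < α → α < 1 →
      ∀ μ₁ μ₂ σ₁ σ₂ ρ : ℝ, 0 < σ₁ → 0 < σ₂ → -1 < ρ → ρ < 1 →
        BivariateNormal.coverage n a b α μ₁ μ₂ σ₁ σ₂ ρ =
          BivariateNormal.chiSquared (n - 2)
            (Set.Ioi (BivariateNormal.quantile (BivariateNormal.chiSquared (n - b)) α)) ∧
        (BivariateNormal.coverage n a b α μ₁ μ₂ σ₁ σ₂ ρ = ENNReal.ofReal (1 - α) ↔
          b = 2)) := by
  have hn3 : (3 : ℝ) ≤ n := by exact_mod_cast hn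
  have hχ := BivariateNormal.isPositiveDiffuse_chiSquared (k := (n : ℝ) - b) (by linarith)
  refine ⟨fun X hX => ?_, fun α hα0 hα1 μ₁ μ₂ σ₁ σ₂ ρ hσ₁ hσ₂ h1 h2 => ?_⟩
  · obtain ⟨hprob, hlaw⟩ := BivariateNormal.posterior_spec (by omega) ha hb X hX
    refine ⟨hprob, hlaw, fun α hα0 hα1 q => ?_⟩
    rw [hlaw]
    exact (hχ.map_const_div (BivariateNormal.residual_pos_of_nondegenerate X hX)).Iio_eq_iff
      (by linarith) (by linarith) q
  · have hcov := BivariateNormal.coverage_eq hn ha hb hα0 hα1 μ₁ μ₂ hσ₁ hσ₂ h1 h2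
    refine ⟨hcov, ?_⟩
    -- Rewriting 1 - α as the χ²_{n-b} tail beyond its own α-quantile leaves two gamma tails at one
    -- positive point, so the shapes (n-2)/2 and (n-b)/2 must agree.
    rw [hcov, ← hχ.Ioi_quantile hα0 hα1]
    refine (BivariateNormal.gammaMeasure_Ioi_eq_iff (p := ((n : ℝ) - 2) / 2)
      (q := ((n : ℝ) - b) / 2) (by linarith) (by linarith) (by norm_num)
      (hχ.quantile_pos hα0 hα1)).trans ?_
    constructor <;> intro h <;> linarith
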